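/- Let $0=r_0<r_1<r_2<\cdots$ be a strictly increasing sequence of real numbers with $\lim_{n\to\infty} r_n=\infty$ that satisfies the Müntz condition $\sum_{i=1}^{\infty} 1/r_i=\infty$, and let $0<a<1$. For $m\ge 0$ let $E(\Lambda_m)=\mathrm{span}(1,t^{r_1},\dots,t^{r_m})$, and let $(B^m_0,\dots,B^m_m)$ be its Chebyshev–Bernstein basis over $[a,1]$, i.e. the unique basis of $E(\Lambda_m)$ such that $\sum_{i=0}^m B^m_i=1$ and, for every $i$, $B^m_i$ has $i$ zeros at $a$ and $m-i$ zeros at $1$ (counted with multiplicity). For $P\in E(\Lambda_m)$, let $\eta_i(P,\Lambda_m,[a,1])$, $i=0,\dots,m$, be the Chebyshev–Bézier control points of $P$ over $[a,1]$, i.e. the coefficients in $P=\sum_{i=0}^m \eta_i(P,\Lambda_m,[a,1])\,B^m_i$. Then for every positive integer $k$, $$\lim_{m\to\infty}\ \max_{0\le i\le m}\left|\eta_i(t^{r_1},\Lambda_m,[a,1])^{r_k/r_1}-\eta_i(t^{r_k},\Lambda_m,[a,1])\right|=0,$$ where $m$ ranges over the integers $m\ge k$. -/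

import Mathlib

namespace MuntzElevation

/-- The Müntz space `E(Λ_n) = span (t ^ r 0, t ^ r 1, …, t ^ r n)`. -/
def MuntzSpace (r : ℕ → ℝ) (n : ℕ) : Submodule ℝ (ℝ → ℝ) :=
  Submodule.span ℝ (Set.range fun (i : Fin (n + 1)) (t : ℝ) => t ^ r i)

/-- The function `t ^ r k` as an element of the Müntz space `E(Λ_m)`, where `k ≤ m`. -/
noncomputable def muntzPower (r : ℕ → ℝ) {k m : ℕ} (hk : k ≤ m) : MuntzSpace r m :=
  ⟨fun t => t ^ r k, Submodule.subset_span ⟨⟨k, Nat.lt_succ_of_le hk⟩, rfl⟩⟩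

/-- `f` has a zero of multiplicity exactly `k` at `x` (no zero if `k = 0`). -/
def HasZeroOfOrder (f : ℝ → ℝ) (x : ℝ) (k : ℕ) : Prop :=
  (∀ j < k, iteratedDeriv j f x = 0) ∧ iteratedDeriv k f x ≠ 0

/-- A basis `B 0, …, B n` of `E(Λ_n)` is the Chebyshev-Bernstein basis over `[a, b]` if `B k` has
`k` zeros at `a` and `n - k` zeros at `b` (with multiplicity) for every `k`,
and it is normalized: the sum of the `B k` is the constant function `1`. -/
def IsChebyshevBernsteinBasis {r : ℕ → ℝ} {n : ℕ} (a b : ℝ)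
    (B : Module.Basis (Fin (n + 1)) ℝ (MuntzSpace r n)) : Prop :=
  (∀ k : Fin (n + 1), HasZeroOfOrder (B k : ℝ → ℝ) a k ∧
    HasZeroOfOrder (B k : ℝ → ℝ) b (n - k)) ∧
  ∀ t : ℝ, ∑ k, (B k : ℝ → ℝ) t = 1

section Existence

open Polynomial

/-- Rolle: between the points of a finite set of zeros there are enough zeros of the derivative. -/
theorem exists_deriv_zeros (g g' : ℝ → ℝ) (a b : ℝ) (ha : 0 < a)
    (hg : ∀ x, 0 < x → HasDerivAt g (g' x) x) (S : Finset ℝ)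
    (hS : ∀ x ∈ S, a ≤ x ∧ x ≤ b ∧ g x = 0) :
    ∃ T : Finset ℝ, (∀ t ∈ T, a < t ∧ g' t = 0 ∧ ∃ s ∈ S, t < s) ∧ S.card ≤ T.card + 1 := by
  classical
  induction S using Finset.induction_on_max with
  | empty => exact ⟨∅, by simp, by simp⟩
  | insert M S hM ih =>
    obtain ⟨T, hT, hc⟩ := ih (fun x hx => hS x (Finset.mem_insert_of_mem hx))
    have hMS : M ∉ S := fun h => lt_irrefl _ (hM M h)
    rcases S.eq_empty_or_nonempty with rfl | hne
    · exact ⟨∅, by simp, by simp⟩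
    have hm := S.max'_mem hne
    have h1 := hS _ (Finset.mem_insert_of_mem hm)
    have h2 := hS M (Finset.mem_insert_self _ _)
    have hlt := hM _ hm
    obtain ⟨z, hz, hz'⟩ := exists_hasDerivAt_eq_zero (f := g) (f' := g') hlt
      (fun x hx => (hg x (by linarith [hx.1])).continuousAt.continuousWithinAt)
      (by rw [h1.2.2, h2.2.2]) (fun x hx => hg x (by linarith [hx.1]))
    have hzT : z ∉ T := by
      intro h
      obtain ⟨_, _, s, hs, hts⟩ := hT z h
      have := S.le_max' s hs
      linarith [hz.1]
    refine ⟨insert z T, ?_, ?_⟩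
    · intro t ht
      rcases Finset.mem_insert.1 ht with rfl | ht
      · exact ⟨by linarith [hz.1], hz', M, Finset.mem_insert_self _ _, hz.2⟩
      · obtain ⟨h3, h4, s, hs, hts⟩ := hT t ht
        exact ⟨h3, h4, s, Finset.mem_insert_of_mem hs, hts⟩
    · rw [Finset.card_insert_of_notMem hzT, Finset.card_insert_of_notMem hMS]
      omega

/-- A real-exponent sum with too many zeros in `[a, b]`, counted with multiplicity at the end
points, has only zero coefficients. -/
theorem coeff_eq_zero_of_zeros {ι : Type*} (e : ι → ℝ) {a b : ℝ} (ha : 0 < a) (hab : a < b)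
    (s : Finset ι) : ∀ (_ : Set.InjOn e s) (c : ι → ℝ) (p q : ℕ) (Z : Finset ℝ)
    (_ : ∀ z ∈ Z, a < z ∧ z < b ∧ ∑ i ∈ s, c i * z ^ e i = 0)
    (_ : ∀ P : ℝ[X], P.degree < p → ∑ i ∈ s, c i * P.eval (e i) * a ^ e i = 0)
    (_ : ∀ P : ℝ[X], P.degree < q → ∑ i ∈ s, c i * P.eval (e i) * b ^ e i = 0)
    (_ : s.card ≤ p + q + Z.card), ∀ i ∈ s, c i = 0 := by
  classical
  induction s using Finset.induction_on with
  | empty => simp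
  | insert i0 s hi0 ih =>
    intro he c p q Z hZ hp hq hcard
    have hb : 0 < b := ha.trans hab
    have value : ∀ (x : ℝ) (m : ℕ), 0 < m →
        (∀ P : ℝ[X], P.degree < m → ∑ i ∈ insert i0 s, c i * P.eval (e i) * x ^ e i = 0) →
        ∑ i ∈ insert i0 s, c i * x ^ e i = 0 := by
      intro x m hm h
      have := h 1 (by rw [degree_one]; exact_mod_cast hm)
      simpa using this
    have twist : ∀ (x : ℝ) (m : ℕ),
        (∀ P : ℝ[X], P.degree < m → ∑ i ∈ insert i0 s, c i * P.eval (e i) * x ^ e i = 0) →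
        ∀ P : ℝ[X], P.degree < (m - 1 : ℕ) →
          ∑ i ∈ s, (c i * (e i - e i0)) * P.eval (e i) * x ^ e i = 0 := by
      intro x m h P hP
      rcases eq_or_ne P 0 with rfl | hP0
      · simp
      have hdeg : ((X - C (e i0)) * P).degree < (m : WithBot ℕ) := by
        rw [degree_mul, degree_X_sub_C, degree_eq_natDegree hP0]
        rw [degree_eq_natDegree hP0] at hP
        have : P.natDegree < m - 1 := by exact_mod_cast hP
        have : 1 + P.natDegree < m := by omega
        exact_mod_cast this
      have := h _ hdeg
      rw [Finset.sum_insert hi0] at this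
      simp only [eval_mul, eval_sub, eval_X, eval_C, sub_self, zero_mul, mul_zero, zero_add] at this
      rw [← this]
      exact Finset.sum_congr rfl fun i _ => by ring
    -- the zeros of the twisted derivative
    set S : Finset ℝ := Z ∪ ((if 0 < p then {a} else ∅) ∪ (if 0 < q then {b} else ∅)) with hSdef
    have hSz : ∀ x ∈ S, a ≤ x ∧ x ≤ b ∧ ∑ i ∈ insert i0 s, c i * x ^ e i = 0 := by
      intro x hx
      rw [hSdef, Finset.mem_union, Finset.mem_union] at hx
      rcases hx with hx | hx | hx
      · exact ⟨(hZ x hx).1.le, (hZ x hx).2.1.le, (hZ x hx).2.2⟩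
      · split_ifs at hx with h
        · rw [Finset.mem_singleton] at hx; subst hx
          exact ⟨le_rfl, hab.le, value _ p h hp⟩
        · simp at hx
      · split_ifs at hx with h
        · rw [Finset.mem_singleton] at hx; subst hx
          exact ⟨hab.le, le_rfl, value _ q h hq⟩
        · simp at hx
    have hScard : Z.card + ((if 0 < p then 1 else 0) + (if 0 < q then 1 else 0)) = S.card := by
      have hd1 : Disjoint (if 0 < p then ({a} : Finset ℝ) else ∅)
          (if 0 < q then ({b} : Finset ℝ) else ∅) := by
        split_ifs <;> simp [hab.ne]
      have hd2 : Disjoint Z ((if 0 < p then ({a} : Finset ℝ) else ∅) ∪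
          (if 0 < q then ({b} : Finset ℝ) else ∅)) := by
        rw [Finset.disjoint_left]
        intro z hz hz'
        have h1 := hZ z hz
        rw [Finset.mem_union] at hz'
        rcases hz' with h | h
        · split_ifs at h
          · rw [Finset.mem_singleton] at h; linarith [h1.1]
          · simp at h
        · split_ifs at h
          · rw [Finset.mem_singleton] at h; linarith [h1.2.1]
          · simp at h
      rw [hSdef, Finset.card_union_of_disjoint hd2, Finset.card_union_of_disjoint hd1]
      congr 2 <;> split_ifs <;> simp
    let g : ℝ → ℝ := fun x => ∑ i ∈ insert i0 s, c i * x ^ (e i - e i0)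
    have hgx : ∀ x, 0 < x → g x = x ^ (-e i0) * ∑ i ∈ insert i0 s, c i * x ^ e i := by
      intro x hx
      rw [Finset.mul_sum]
      refine Finset.sum_congr rfl fun i _ => ?_
      rw [sub_eq_neg_add, Real.rpow_add hx]; ring
    have hder : ∀ x, 0 < x →
        HasDerivAt g (∑ i ∈ insert i0 s, c i * ((e i - e i0) * x ^ (e i - e i0 - 1))) x := by
      intro x hx
      refine HasDerivAt.fun_sum fun i _ => ?_
      exact (Real.hasDerivAt_rpow_const (Or.inl hx.ne')).const_mul _
    obtain ⟨T, hT, hTc⟩ := exists_deriv_zeros g _ a b ha hder S (fun x hx => by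
      obtain ⟨h1, h2, h3⟩ := hSz x hx
      exact ⟨h1, h2, by rw [hgx x (ha.trans_le h1), h3, mul_zero]⟩)
    have hs0 : ∀ i ∈ s, c i * (e i - e i0) = 0 := by
      refine ih (he.mono (by simp)) (fun i => c i * (e i - e i0)) (p - 1) (q - 1) T
        ?_ (twist a p hp) (twist b q hq) ?_
      · intro t ht
        obtain ⟨h1, h2, x, hx, htx⟩ := hT t ht
        have ht0 : 0 < t := ha.trans h1
        refine ⟨h1, htx.trans_le (hSz x hx).2.1, ?_⟩
        rw [Finset.sum_insert hi0, sub_self, zero_mul, mul_zero, zero_add] at h2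
        have h4 : ∑ i ∈ s, c i * (e i - e i0) * t ^ e i
            = t ^ (e i0 + 1) * ∑ i ∈ s, c i * ((e i - e i0) * t ^ (e i - e i0 - 1)) := by
          rw [Finset.mul_sum]
          refine Finset.sum_congr rfl fun i _ => ?_
          have : e i = (e i0 + 1) + (e i - e i0 - 1) := by ring
          conv_lhs => rw [this, Real.rpow_add ht0]
          ring_nf
        rw [h4, h2, mul_zero]
      · rw [Finset.card_insert_of_notMem hi0] at hcard
        split_ifs at hScard <;> omega
    have hs : ∀ i ∈ s, c i = 0 := by
      intro i hi
      rcases mul_eq_zero.1 (hs0 i hi) with h | h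
      · exact h
      · exfalso
        have : i = i0 := he (by simp [hi]) (by simp) (sub_eq_zero.1 h)
        exact hi0 (this ▸ hi)
    have hSne : S.Nonempty := by
      rw [← Finset.card_pos]
      rw [Finset.card_insert_of_notMem hi0] at hcard
      split_ifs at hScard <;> omega
    obtain ⟨x, hx⟩ := hSne
    obtain ⟨h1, _, h3⟩ := hSz x hx
    rw [Finset.sum_insert hi0, Finset.sum_eq_zero (fun i hi => by rw [hs i hi, zero_mul]),
      add_zero] at h3
    have hc0 : c i0 = 0 :=
      (mul_eq_zero.1 h3).resolve_right (Real.rpow_pos_of_pos (ha.trans_le h1) _).ne'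
    intro i hi
    rcases Finset.mem_insert.1 hi with rfl | hi
    · exact hc0
    · exact hs i hi

/-- The linear combination of the powers `t ^ r i` with coefficients `c`. -/
noncomputable def powerSum (r : ℕ → ℝ) (n : ℕ) (c : Fin (n + 1) → ℝ) (t : ℝ) : ℝ :=
  ∑ i, c i * t ^ r i

theorem mem_muntzSpace_iff {r : ℕ → ℝ} {n : ℕ} {f : ℝ → ℝ} :
    f ∈ MuntzSpace r n ↔ ∃ c, powerSum r n c = f := by
  rw [MuntzSpace, Submodule.mem_span_range_iff_exists_fun]
  refine exists_congr fun c => ?_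
  have : powerSum r n c = ∑ i, c i • fun t : ℝ => t ^ r i := by
    ext t; simp [powerSum]
  rw [this]

theorem contDiffAt_rpow_const {x : ℝ} (hx : 0 < x) (s : ℝ) (m : WithTop ℕ∞) :
    ContDiffAt ℝ m (fun t : ℝ => t ^ s) x :=
  contDiffAt_id.rpow_const_of_ne hx.ne'

theorem contDiffAt_of_mem {r : ℕ → ℝ} {n : ℕ} {f : ℝ → ℝ} (hf : f ∈ MuntzSpace r n) {x : ℝ}
    (hx : 0 < x) (m : WithTop ℕ∞) : ContDiffAt ℝ m f x := by
  obtain ⟨c, rfl⟩ := mem_muntzSpace_iff.1 hf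
  exact ContDiffAt.sum fun i _ => contDiffAt_const.mul (contDiffAt_rpow_const hx _ _)

theorem iteratedDeriv_powerSum {r : ℕ → ℝ} {n : ℕ} (c : Fin (n + 1) → ℝ) {x : ℝ} (hx : 0 < x)
    (j : ℕ) : x ^ j * iteratedDeriv j (powerSum r n c) x =
      ∑ i, c i * (descPochhammer ℝ j).eval (r i) * x ^ r i := by
  have h : powerSum r n c = fun t => ∑ i, c i * t ^ r i := rfl
  rw [h, iteratedDeriv_fun_sum (fun i _ => contDiffAt_const.mul (contDiffAt_rpow_const hx _ _)),
    Finset.mul_sum]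
  refine Finset.sum_congr rfl fun i _ => ?_
  rw [iteratedDeriv_const_mul_field, iteratedDeriv_eq_iterate, Real.iter_deriv_rpow_const,
    Real.rpow_sub_natCast hx.ne']
  field_simp

/-- Vanishing to order `p` expressed through the operator `t d/dt`. -/
theorem sum_eval_eq_zero {r : ℕ → ℝ} {n : ℕ} (c : Fin (n + 1) → ℝ) {x : ℝ} (hx : 0 < x) (p : ℕ)
    (h : ∀ j < p, iteratedDeriv j (powerSum r n c) x = 0) (P : ℝ[X]) (hP : P.degree < p) :
    ∑ i, c i * P.eval (r i) * x ^ r i = 0 := by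
  induction p generalizing P with
  | zero =>
    have : P = 0 := by
      rw [← degree_eq_bot]
      simpa [Nat.WithBot.lt_zero_iff] using hP
    simp [this]
  | succ p ih =>
    set D := descPochhammer ℝ p
    have hD : D.Monic := monic_descPochhammer ℝ p
    have hDn : D.natDegree = p := descPochhammer_natDegree ℝ p
    have hle : P.degree ≤ (p : WithBot ℕ) := Order.lt_succ_iff.1 (by exact_mod_cast hP)
    have hdeg : (P - C (P.coeff p) * D).degree < p := by
      rw [degree_lt_iff_coeff_zero]
      intro m hm
      rw [coeff_sub, coeff_C_mul]
      rcases hm.eq_or_lt with rfl | hm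
      · have : D.coeff p = 1 := by rw [← hDn]; exact hD
        rw [this]; ring
      · have hDm : D.coeff m = 0 := coeff_eq_zero_of_natDegree_lt (by rw [hDn]; exact hm)
        rw [coeff_eq_zero_of_degree_lt (hle.trans_lt (by exact_mod_cast hm)), hDm]
        ring
    have h1 := ih (fun j hj => h j (by omega)) _ hdeg
    have h2 := iteratedDeriv_powerSum (r := r) c hx p
    rw [h p (by omega), mul_zero] at h2
    have : ∑ i, c i * P.eval (r i) * x ^ r i =
        ∑ i, c i * (P - C (P.coeff p) * D).eval (r i) * x ^ r i +
          P.coeff p * ∑ i, c i * D.eval (r i) * x ^ r i := by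
      rw [Finset.mul_sum, ← Finset.sum_add_distrib]
      refine Finset.sum_congr rfl fun i _ => ?_
      simp only [eval_sub, eval_mul, eval_C]; ring
    rw [this, h1, ← h2]; ring

variable {r : ℕ → ℝ} {n : ℕ} {a b : ℝ}

theorem injective_exponents (hr : StrictMono r) : Function.Injective fun i : Fin (n + 1) => r i :=
  fun _ _ h => Fin.ext (hr.injective h)

/-- A power sum with `n + 1` zeros at the end points vanishes. -/
theorem coeff_eq_zero (hr : StrictMono r) (ha : 0 < a) (hab : a < b) (c : Fin (n + 1) → ℝ)
    (p q : ℕ) (hpq : n + 1 ≤ p + q) (hp : ∀ j < p, iteratedDeriv j (powerSum r n c) a = 0)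
    (hq : ∀ j < q, iteratedDeriv j (powerSum r n c) b = 0) : c = 0 := by
  funext i
  refine coeff_eq_zero_of_zeros (fun i : Fin (n + 1) => r i) ha hab Finset.univ
    (injective_exponents hr).injOn c p q ∅ (by simp) (sum_eval_eq_zero c ha p hp)
    (sum_eval_eq_zero c (ha.trans hab) q hq) (by simpa using hpq) i (Finset.mem_univ _)

theorem eq_zero_of_mem (hr : StrictMono r) (ha : 0 < a) (hab : a < b) {f : ℝ → ℝ}
    (hf : f ∈ MuntzSpace r n) (p q : ℕ) (hpq : n + 1 ≤ p + q)
    (hp : ∀ j < p, iteratedDeriv j f a = 0) (hq : ∀ j < q, iteratedDeriv j f b = 0) : f = 0 := by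
  obtain ⟨c, rfl⟩ := mem_muntzSpace_iff.1 hf
  rw [coeff_eq_zero hr ha hab c p q hpq hp hq]
  ext t; simp [powerSum]

/-- Hermite interpolation at the end points: a function with `k` zeros at `a` and `n - k` zeros
at `b`. -/
theorem exists_hasZeroOfOrder (hr : StrictMono r) (ha : 0 < a) (hab : a < b) (k : Fin (n + 1)) :
    ∃ f : MuntzSpace r n, HasZeroOfOrder (f : ℝ → ℝ) a k ∧
      HasZeroOfOrder (f : ℝ → ℝ) b (n - k) := by
  have hb := ha.trans hab
  -- the jet of length `k + 1` at `a` and the jet of length `n - k` at `b`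
  let J : (Fin (n + 1) → ℝ) →ₗ[ℝ] (Fin (n + 1) → ℝ) :=
    { toFun := fun c j => if j ≤ k then ∑ i, c i * (descPochhammer ℝ j).eval (r i) * a ^ r i
        else ∑ i, c i * (descPochhammer ℝ (j - (k + 1))).eval (r i) * b ^ r i
      map_add' := by
        intro c d; funext j
        simp only [Pi.add_apply]
        split_ifs <;> rw [← Finset.sum_add_distrib] <;>
          exact Finset.sum_congr rfl fun i _ => by ring
      map_smul' := by
        intro c d; funext j
        simp only [Pi.smul_apply, smul_eq_mul, RingHom.id_apply]
        split_ifs <;> rw [Finset.mul_sum] <;>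
          exact Finset.sum_congr rfl fun i _ => by ring }
  have hJa : ∀ c (j : ℕ) (hj : j ≤ k),
      J c ⟨j, by omega⟩ = a ^ j * iteratedDeriv j (powerSum r n c) a := by
    intro c j hj
    rw [iteratedDeriv_powerSum c ha]
    exact if_pos (Fin.le_def.2 hj)
  have hJb : ∀ c (j : ℕ) (hj : j < n - k),
      J c ⟨j + (k + 1), by omega⟩ = b ^ j * iteratedDeriv j (powerSum r n c) b := by
    intro c j hj
    rw [iteratedDeriv_powerSum c hb]
    have h1 : ¬ ((⟨j + (k + 1), by omega⟩ : Fin (n + 1)) ≤ k) := by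
      rw [Fin.le_def]; simp only; omega
    refine (if_neg h1).trans ?_
    simp only [Nat.add_sub_cancel]
  have hinj : Function.Injective J := by
    rw [← LinearMap.ker_eq_bot, LinearMap.ker_eq_bot']
    intro c hc
    refine coeff_eq_zero hr ha hab c (k + 1) (n - k) (by omega) (fun j hj => ?_) (fun j hj => ?_)
    · have := hJa c j (by omega)
      rw [hc] at this
      exact (mul_eq_zero.1 this.symm).resolve_left (pow_pos ha j).ne'
    · have := hJb c j hj
      rw [hc] at this
      exact (mul_eq_zero.1 this.symm).resolve_left (pow_pos hb j).ne'
  obtain ⟨c, hc⟩ := (LinearMap.injective_iff_surjective.1 hinj) (Pi.single k 1)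
  have hmem : powerSum r n c ∈ MuntzSpace r n := mem_muntzSpace_iff.2 ⟨c, rfl⟩
  have hva : ∀ j < (k : ℕ), iteratedDeriv j (powerSum r n c) a = 0 := by
    intro j hj
    have := hJa c j hj.le
    rw [hc, Pi.single_eq_of_ne (by rw [Ne, Fin.ext_iff]; exact hj.ne)] at this
    exact (mul_eq_zero.1 this.symm).resolve_left (pow_pos ha j).ne'
  have hvb : ∀ j < n - (k : ℕ), iteratedDeriv j (powerSum r n c) b = 0 := by
    intro j hj
    have := hJb c j hj
    rw [hc, Pi.single_eq_of_ne (by rw [Ne, Fin.ext_iff]; simp only; omega)] at this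
    exact (mul_eq_zero.1 this.symm).resolve_left (pow_pos hb j).ne'
  have hne : iteratedDeriv k (powerSum r n c) a ≠ 0 := by
    intro h0
    have := hJa c k le_rfl
    rw [hc, h0, mul_zero] at this
    simp at this
  refine ⟨⟨_, hmem⟩, ⟨hva, hne⟩, hvb, fun h0 => hne ?_⟩
  have : powerSum r n c = 0 := by
    refine eq_zero_of_mem hr ha hab hmem k (n - k + 1) (by omega) hva fun j hj => ?_
    rcases Nat.lt_succ_iff_lt_or_eq.1 hj with h | rfl
    · exact hvb j h
    · exact h0
  rw [this]
  simp

theorem iteratedDeriv_sum_smul (f : Fin (n + 1) → MuntzSpace r n) (w : Fin (n + 1) → ℝ)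
    (s : Finset (Fin (n + 1))) {x : ℝ} (hx : 0 < x) (j : ℕ) :
    iteratedDeriv j ((∑ i ∈ s, w i • f i : MuntzSpace r n) : ℝ → ℝ) x =
      ∑ i ∈ s, w i * iteratedDeriv j (f i : ℝ → ℝ) x := by
  have h : ((∑ i ∈ s, w i • f i : MuntzSpace r n) : ℝ → ℝ) =
      fun t => ∑ i ∈ s, w i * (f i : ℝ → ℝ) t := by
    ext t; simp
  rw [h, iteratedDeriv_fun_sum
    (fun i _ => contDiffAt_const.mul (contDiffAt_of_mem (f i).2 hx _))]
  exact Finset.sum_congr rfl fun i _ => iteratedDeriv_const_mul_field _ _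

theorem linearIndependent_of_zeros (ha : 0 < a) (f : Fin (n + 1) → MuntzSpace r n)
    (hf : ∀ k : Fin (n + 1), HasZeroOfOrder (f k : ℝ → ℝ) a k) : LinearIndependent ℝ f := by
  rw [Fintype.linearIndependent_iff]
  intro w hw
  by_contra! hne
  obtain ⟨k, hk, hmin⟩ : ∃ k, w k ≠ 0 ∧ ∀ j < k, w j = 0 := by
    classical
    obtain ⟨k, hk, hmin⟩ := WellFounded.has_min (wellFounded_lt (α := Fin (n + 1)))
      {k | w k ≠ 0} hne
    exact ⟨k, hk, fun j hj => by by_contra h; exact hmin j h hj⟩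
  have h := iteratedDeriv_sum_smul f w Finset.univ ha k
  rw [hw, Finset.sum_eq_single k] at h
  · have h0 : iteratedDeriv k ((0 : MuntzSpace r n) : ℝ → ℝ) a = 0 := by simp
    rw [h0] at h
    exact mul_ne_zero hk (hf k).2 h.symm
  · intro j _ hj
    rcases lt_or_gt_of_ne hj with hlt | hgt
    · rw [hmin j hlt, zero_mul]
    · rw [(hf j).1 k hgt, mul_zero]
  · simp

theorem linearIndependent_powers (hr : StrictMono r) :
    LinearIndependent ℝ fun (i : Fin (n + 1)) (t : ℝ) => t ^ r i := by
  rw [Fintype.linearIndependent_iff]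
  intro c hc
  have : powerSum r n c = 0 := by
    rw [← hc]; ext t; simp [powerSum]
  have := coeff_eq_zero (a := 1) (b := 2) hr one_pos one_lt_two c (n + 1) 0 le_rfl
    (by intro j _; rw [this]; simp) (by simp)
  intro i; rw [this]; rfl

theorem finrank_muntzSpace (hr : StrictMono r) : Module.finrank ℝ (MuntzSpace r n) = n + 1 :=
  (finrank_span_eq_card (linearIndependent_powers (n := n) hr)).trans (by simp)

/-- The derivative of a nonconstant function of the Müntz space has at most `n - 1` zeros. -/
theorem sum_ne_one (h0 : r 0 = 0) (hr : StrictMono r) (ha : 0 < a) (hab : a < b)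
    (f g : MuntzSpace r n) (k : ℕ) (hk : k ≤ n)
    (hf : ∀ j < n - k + 1, iteratedDeriv j (f : ℝ → ℝ) b = 0)
    (hg : ∀ j < k + 1, iteratedDeriv j (g : ℝ → ℝ) a = 0) :
    ¬ ∀ t : ℝ, (f : ℝ → ℝ) t + (g : ℝ → ℝ) t = 1 := by
  intro hfg
  have hb := ha.trans hab
  obtain ⟨c, hc⟩ := mem_muntzSpace_iff.1 f.2
  obtain ⟨d, hd⟩ := mem_muntzSpace_iff.1 g.2
  rw [← hc] at hf hfg
  rw [← hd] at hg hfg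
  have hcd : c + d = Pi.single 0 1 := by
    have hlin := linearIndependent_powers (n := n) hr
    rw [Fintype.linearIndependent_iff] at hlin
    have := hlin (c + d - Pi.single 0 1) (by
      ext t
      have := hfg t
      simp only [powerSum] at this
      simp only [Pi.sub_apply, Pi.add_apply, Finset.sum_apply, Pi.smul_apply, smul_eq_mul,
        sub_mul, add_mul, Finset.sum_sub_distrib, Finset.sum_add_distrib, this]
      simp [Pi.single_apply, h0])
    funext i
    have h := this i
    simp only [Pi.sub_apply] at h
    linarith
  have hcd' : ∀ i, i ≠ 0 → d i = -c i := by
    intro i hi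
    have := congrFun hcd i
    rw [Pi.add_apply, Pi.single_eq_of_ne hi] at this
    linarith
  have hXdeg : ∀ (P : ℝ[X]) (m : ℕ), P.degree < (m : WithBot ℕ) → (P * X).degree < ((m + 1 : ℕ) : WithBot ℕ) := by
    intro P m hP
    rcases eq_or_ne P 0 with rfl | hP0
    · simp
    rw [degree_mul, degree_X, degree_eq_natDegree hP0]
    rw [degree_eq_natDegree hP0] at hP
    have : P.natDegree < m := by exact_mod_cast hP
    have : P.natDegree + 1 < m + 1 := by omega
    exact_mod_cast this
  have herase : ∀ F : Fin (n + 1) → ℝ, F 0 = 0 →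
      ∑ i ∈ Finset.univ.erase 0, F i = ∑ i, F i := by
    intro F hF
    exact Finset.sum_erase _ hF
  have hzero := coeff_eq_zero_of_zeros (fun i : Fin (n + 1) => r i) ha hab
    (Finset.univ.erase 0) (injective_exponents hr).injOn (fun i => c i * r i) k (n - k) ∅
    (by simp) (fun P hP => by
      have h1 := sum_eval_eq_zero d ha (k + 1) hg (P * X) (hXdeg P k hP)
      rw [herase _ (by simp [h0]), ← neg_eq_zero, ← h1, ← Finset.sum_neg_distrib]
      refine Finset.sum_congr rfl fun i _ => ?_
      simp only [eval_mul, eval_X]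
      rcases eq_or_ne i 0 with rfl | hi
      · simp [h0]
      · rw [hcd' i hi]; ring)
    (fun P hP => by
      have h1 := sum_eval_eq_zero c hb (n - k + 1) hf (P * X) (hXdeg P _ hP)
      rw [herase _ (by simp [h0]), ← h1]
      refine Finset.sum_congr rfl fun i _ => ?_
      simp only [eval_mul, eval_X]; ring)
    (by simp; omega)
  have hc0 : ∀ i, i ≠ 0 → c i = 0 := by
    intro i hi
    refine (mul_eq_zero.1 (hzero i (by simp [hi]))).resolve_right ?_
    have : r 0 < r i := hr (Nat.pos_of_ne_zero fun h => hi (Fin.ext h))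
    rw [h0] at this
    exact this.ne'
  have hfb := hf 0 (by omega)
  have hga := hg 0 (by omega)
  rw [iteratedDeriv_zero, powerSum, Finset.sum_eq_single 0
    (fun i _ hi => by rw [hc0 i hi, zero_mul]) (by simp)] at hfb
  rw [iteratedDeriv_zero, powerSum, Finset.sum_eq_single 0
    (fun i _ hi => by rw [hcd' i hi, hc0 i hi, neg_zero, zero_mul]) (by simp)] at hga
  have := congrFun hcd 0
  simp [h0] at hfb hga this
  linarith

/-- The Chebyshev-Bernstein basis of a Müntz space over `[a, b]` exists and is unique. -/
theorem existsUnique_chebyshevBernsteinBasis (h0 : r 0 = 0) (hr : StrictMono r) (ha : 0 < a)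
    (hab : a < b) (n : ℕ) :
    ∃! B : Module.Basis (Fin (n + 1)) ℝ (MuntzSpace r n), IsChebyshevBernsteinBasis a b B := by
  have hb := ha.trans hab
  have hone : (fun _ => 1 : ℝ → ℝ) ∈ MuntzSpace r n :=
    Submodule.subset_span ⟨0, by ext t; simp [h0]⟩
  have existence : ∃ B : Module.Basis (Fin (n + 1)) ℝ (MuntzSpace r n),
      IsChebyshevBernsteinBasis a b B := by
    choose f hfa hfb using fun k : Fin (n + 1) => exists_hasZeroOfOrder hr ha hab k
    let B0 := basisOfLinearIndependentOfCardEqFinrank (linearIndependent_of_zeros ha f hfa)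
      (by rw [finrank_muntzSpace hr]; simp)
    have hB0 : ∀ k, B0 k = f k := fun k => by simp [B0]
    let w : Fin (n + 1) → ℝ := fun k => B0.repr ⟨_, hone⟩ k
    have hsum : ∑ k, w k • f k = ⟨_, hone⟩ := by
      have := B0.sum_repr ⟨_, hone⟩
      simpa only [hB0] using this
    have hsum' : ∀ t, ∑ k, w k * (f k : ℝ → ℝ) t = 1 := by
      intro t
      have := congrArg (fun F : MuntzSpace r n => (F : ℝ → ℝ) t) hsum
      simpa using this
    have hw : ∀ k, w k ≠ 0 := by
      intro k hk
      refine sum_ne_one h0 hr ha hab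
        (∑ i ∈ Finset.univ.filter (· < k), w i • f i)
        (∑ i ∈ Finset.univ.filter (¬ · < k), w i • f i) k (by omega) ?_ ?_ ?_
      · intro j hj
        rw [iteratedDeriv_sum_smul _ _ _ hb]
        refine Finset.sum_eq_zero fun i hi => ?_
        have hik : (i : ℕ) < k := (Finset.mem_filter.1 hi).2
        rw [(hfb i).1 j (by omega), mul_zero]
      · intro j hj
        rw [iteratedDeriv_sum_smul _ _ _ ha]
        refine Finset.sum_eq_zero fun i hi => ?_
        have hik : ¬ i < k := (Finset.mem_filter.1 hi).2
        rcases eq_or_ne i k with rfl | hne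
        · rw [hk, zero_mul]
        · have : (k : ℕ) < i := lt_of_le_of_ne (not_lt.1 hik) (fun h => hne (Fin.ext h.symm))
          rw [(hfa i).1 j (by omega), mul_zero]
      · intro t
        rw [← hsum' t, ← Finset.sum_filter_add_sum_filter_not Finset.univ (· < k)]
        simp
    refine ⟨B0.isUnitSMul fun k => (hw k).isUnit, fun k => ?_, fun t => ?_⟩
    · have hcoe : ((B0.isUnitSMul (fun k => (hw k).isUnit) k : MuntzSpace r n) : ℝ → ℝ) =
          fun t => w k * (f k : ℝ → ℝ) t := by
        rw [Module.Basis.isUnitSMul_apply, hB0]; ext t; simp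
      rw [hcoe]
      refine ⟨⟨fun j hj => ?_, ?_⟩, fun j hj => ?_, ?_⟩
      · rw [iteratedDeriv_const_mul_field, (hfa k).1 j hj, mul_zero]
      · rw [iteratedDeriv_const_mul_field]; exact mul_ne_zero (hw k) (hfa k).2
      · rw [iteratedDeriv_const_mul_field, (hfb k).1 j hj, mul_zero]
      · rw [iteratedDeriv_const_mul_field]; exact mul_ne_zero (hw k) (hfb k).2
    · rw [← hsum' t]
      refine Finset.sum_congr rfl fun k _ => ?_
      rw [Module.Basis.isUnitSMul_apply, hB0]; simp
  obtain ⟨B, hB⟩ := existence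
  refine ⟨B, hB, fun B' hB' => ?_⟩
  have key : ∀ k, ∃ l : ℝ, B' k = l • B k := by
    intro k
    refine ⟨iteratedDeriv k (B' k : ℝ → ℝ) a / iteratedDeriv k (B k : ℝ → ℝ) a, ?_⟩
    set l := iteratedDeriv k (B' k : ℝ → ℝ) a / iteratedDeriv k (B k : ℝ → ℝ) a with hl
    have hit : ∀ x, 0 < x → ∀ j, iteratedDeriv j ((B' k - l • B k : MuntzSpace r n) : ℝ → ℝ) x =
        iteratedDeriv j (B' k : ℝ → ℝ) x - l * iteratedDeriv j (B k : ℝ → ℝ) x := by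
      intro x hx j
      have : ((B' k - l • B k : MuntzSpace r n) : ℝ → ℝ) =
          fun t => (B' k : ℝ → ℝ) t - l * (B k : ℝ → ℝ) t := by ext t; simp
      rw [this, iteratedDeriv_fun_sub (contDiffAt_of_mem (B' k).2 hx _)
        (contDiffAt_const.mul (contDiffAt_of_mem (B k).2 hx _)), iteratedDeriv_const_mul_field]
    have hz := eq_zero_of_mem hr ha hab (B' k - l • B k).2 (k + 1) (n - k) (by omega)
      (fun j hj => by
        rw [hit a ha]
        rcases Nat.lt_succ_iff_lt_or_eq.1 hj with h | rfl
        · rw [(hB'.1 k).1.1 j h, (hB.1 k).1.1 j h]; ring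
        · rw [hl, div_mul_cancel₀ _ (hB.1 k).1.2, sub_self])
      (fun j hj => by
        rw [hit b hb, (hB'.1 k).2.1 j hj, (hB.1 k).2.1 j hj]; ring)
    exact sub_eq_zero.1 (Subtype.ext hz)
  choose l hl using key
  have hlin := Fintype.linearIndependent_iff.1 B.linearIndependent (fun k => l k - 1) (by
    apply Subtype.ext
    ext t
    have h1 := hB.2 t
    have h2 := hB'.2 t
    simp only [hl] at h2
    simp only [sub_smul, one_smul, Finset.sum_sub_distrib]
    simp at h1 h2 ⊢
    rw [h1, h2, sub_self])
  refine Module.Basis.eq_of_apply_eq fun k => ?_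
  rw [hl k, sub_eq_zero.1 (hlin k), one_smul]

end Existence

/-- The Chebyshev-Bernstein basis of `E(Λ_n)` over `[a, b]`, `0 < a < b`. -/
noncomputable def chebyshevBernsteinBasis {r : ℕ → ℝ} (h0 : r 0 = 0) (hr : StrictMono r)
    {a b : ℝ} (ha : 0 < a) (hab : a < b) (n : ℕ) :
    Module.Basis (Fin (n + 1)) ℝ (MuntzSpace r n) :=
  (existsUnique_chebyshevBernsteinBasis h0 hr ha hab n).choose

theorem isChebyshevBernsteinBasis {r : ℕ → ℝ} (h0 : r 0 = 0) (hr : StrictMono r)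
    {a b : ℝ} (ha : 0 < a) (hab : a < b) (n : ℕ) :
    IsChebyshevBernsteinBasis a b (chebyshevBernsteinBasis h0 hr ha hab n) :=
  (existsUnique_chebyshevBernsteinBasis h0 hr ha hab n).choose_spec.1

/-- The Chebyshev-Bézier control points `η_0, …, η_n` of `P ∈ E(Λ_n)` over `[a, b]`: the
coefficients in `P = ∑ i, η_i • B_i`, with `B` the Chebyshev-Bernstein basis over `[a, b]`. -/
noncomputable def controlPoint {r : ℕ → ℝ} (h0 : r 0 = 0) (hr : StrictMono r)
    {a b : ℝ} (ha : 0 < a) (hab : a < b) {n : ℕ} (P : MuntzSpace r n) (i : Fin (n + 1)) : ℝ :=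
  (chebyshevBernsteinBasis h0 hr ha hab n).repr P i

end MuntzElevation

/-! The control points of all powers come from one rational interpolation problem. Let `q`, `p` have
degrees at most `m - i` and `i`, with `q(x) = a ^ x * p(x)` at the nodes `r 0, …, r m` and `q(0) =
1`. The functional `t ^ r x ↦ q(r x)` kills every `B l` with `l ≠ i`: for `l < i` because of the
zeros at `1`, for `l > i` because of the zeros at `a`, where `p` takes the place of `q`. Hence
`η_i(t ^ r j) = q(r j)` (`controlPoint_muntzPower`). Rolle's theorem makes the interpolant unique up
to scaling and fixes the signs of its leading coefficients and of its values at the nodes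
(`IsInterpolant.eval_pos`).

Upper bound, valid for every `m`: the points `(η_i(t ^ r 1), η_i(t ^ r k))` form an increasing
convex polygon (`polygon_convex`). The point of the curve `(t ^ r 1, t ^ r k)` above a vertex is an
average of all the vertices with positive weights `B l t`, so it lies above the supporting line at
that vertex. This gives `η_i(t ^ r k) ≤ η_i(t ^ r 1) ^ (r k / r 1)` (`controlPoint_le_rpow`).

Lower bound up to `δ`, uniform in `i`: `q(r x)` is an average, with weights not depending on `x`, of
the products `∏_{j < l ≤ m} (1 - r x / r l)` (`IsInterpolant.exists_weights`). By Jensen's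
inequality it suffices to compare the products for `x = 1` and `x = k`. For large `j` both are close
to exponentials of `∑ 1 / r l`; for small `j` the power of the first is small, by the Müntz
condition (`prod_rpow_sub_le`). -/

namespace MuntzElevation

open Polynomial

/-! ### Rolle's theorem for `q - a ^ x * p`. -/

/-- Rolle: a function with `n + 1` zeros on the line has a derivative with `n` zeros. -/
theorem exists_deriv_zeros_line (g g' : ℝ → ℝ) (hg : ∀ x, HasDerivAt g (g' x) x) (S : Finset ℝ)
    (hS : ∀ x ∈ S, g x = 0) :
    ∃ T : Finset ℝ, (∀ t ∈ T, g' t = 0) ∧ S.card ≤ T.card + 1 := by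
  classical
  -- Translation by `c + 1` moves `S` into `[1, ∞)`, since `exists_deriv_zeros` works on the
  -- positive axis.
  obtain ⟨c, hc⟩ := (S.image fun x => -x).bddAbove
  have hder : ∀ x, 0 < x → HasDerivAt (fun x => g (x - (c + 1))) (g' (x - (c + 1))) x := by
    intro x _
    exact (hg (x - (c + 1))).comp_sub_const x (c + 1)
  obtain ⟨b, hb⟩ := (S.image fun x => x + (c + 1)).bddAbove
  obtain ⟨T, hT, hcard⟩ := exists_deriv_zeros _ _ 1 b one_pos hder (S.image fun x => x + (c + 1)) (by
    intro y hy
    refine ⟨?_, hb hy, ?_⟩ <;> obtain ⟨x, hx, rfl⟩ := Finset.mem_image.1 hy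
    · have := hc (Finset.mem_coe.2 (Finset.mem_image_of_mem _ hx))
      linarith
    · simpa using hS x hx)
  refine ⟨T.image fun x => x - (c + 1), ?_, ?_⟩
  · intro t ht
    obtain ⟨x, hx, rfl⟩ := Finset.mem_image.1 ht
    exact (hT x hx).2.1
  · rw [Finset.card_image_of_injective _ (add_left_injective _)] at hcard
    rwa [Finset.card_image_of_injective _ (sub_left_injective)]

/-- The operator `p ↦ a ^ (-x) * (a ^ x * p)'` on polynomials. -/
noncomputable def expDeriv (a : ℝ) (p : ℝ[X]) : ℝ[X] := derivative p + C (Real.log a) * p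

theorem mem_degreeLT_iff_coeff {p : ℝ[X]} {n : ℕ} :
    p ∈ degreeLT ℝ n ↔ ∀ m, n ≤ m → p.coeff m = 0 := by
  rw [mem_degreeLT, degree_lt_iff_coeff_zero]

theorem expDeriv_mem {a : ℝ} {p : ℝ[X]} {n : ℕ} (hp : p ∈ degreeLT ℝ n) :
    expDeriv a p ∈ degreeLT ℝ n := by
  rw [mem_degreeLT_iff_coeff] at *
  intro m hm
  simp [expDeriv, coeff_derivative, hp m hm, hp (m + 1) (by omega)]

/-- Differentiation lowers the degree, so the operator is triangular with `log a` on the diagonal;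
this makes it injective for `log a ≠ 0`. -/
theorem coeff_expDeriv {a : ℝ} {p : ℝ[X]} {n : ℕ} (hp : p ∈ degreeLT ℝ (n + 1)) :
    (expDeriv a p).coeff n = Real.log a * p.coeff n := by
  rw [mem_degreeLT_iff_coeff] at hp
  simp [expDeriv, coeff_derivative, hp (n + 1) le_rfl]

theorem iterate_expDeriv_mem {a : ℝ} {p : ℝ[X]} {n : ℕ} (hp : p ∈ degreeLT ℝ n) (k : ℕ) :
    (expDeriv a)^[k] p ∈ degreeLT ℝ n := by
  induction k with
  | zero => exact hp
  | succ k ih => rw [Function.iterate_succ_apply']; exact expDeriv_mem ih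

theorem coeff_iterate_expDeriv {a : ℝ} {p : ℝ[X]} {n : ℕ} (hp : p ∈ degreeLT ℝ (n + 1)) (k : ℕ) :
    ((expDeriv a)^[k] p).coeff n = Real.log a ^ k * p.coeff n := by
  induction k with
  | zero => simp
  | succ k ih =>
    rw [Function.iterate_succ_apply', coeff_expDeriv (iterate_expDeriv_mem hp k), ih]; ring

theorem eq_zero_of_expDeriv_eq_zero {a : ℝ} (ha : Real.log a ≠ 0) {p : ℝ[X]}
    (h : expDeriv a p = 0) : p = 0 := by
  by_contra hp
  have h1 := coeff_expDeriv (a := a) (p := p) (n := p.natDegree)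
    (by rw [mem_degreeLT, degree_eq_natDegree hp]; exact_mod_cast Nat.lt_succ_self _)
  rw [h, coeff_zero, coeff_natDegree] at h1
  exact mul_ne_zero ha (leadingCoeff_ne_zero.2 hp) h1.symm

theorem eq_zero_of_iterate_expDeriv_eq_zero {a : ℝ} (ha : Real.log a ≠ 0) {p : ℝ[X]} (k : ℕ)
    (h : (expDeriv a)^[k] p = 0) : p = 0 := by
  induction k with
  | zero => exact h
  | succ k ih =>
    rw [Function.iterate_succ_apply'] at h
    exact ih (eq_zero_of_expDeriv_eq_zero ha h)

theorem iterate_derivative_eq_C {q : ℝ[X]} {d : ℕ} (hq : q ∈ degreeLT ℝ (d + 1)) :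
    derivative^[d] q = C (d.factorial * q.coeff d) := by
  rw [mem_degreeLT_iff_coeff] at hq
  ext m
  rw [coeff_iterate_derivative, coeff_C]
  split_ifs with hm
  · subst hm; simp [Nat.descFactorial_self]
  · rw [hq _ (by omega), smul_zero]

/-- Rolle for `q - a ^ x * p`. -/
theorem exists_iterate_deriv_zeros {a : ℝ} (ha : 0 < a) (q p : ℝ[X]) (S : Finset ℝ)
    (h : ∀ x ∈ S, q.eval x = a ^ x * p.eval x) (n : ℕ) :
    ∃ T : Finset ℝ, (∀ x ∈ T, (derivative^[n] q).eval x = a ^ x * ((expDeriv a)^[n] p).eval x) ∧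
      S.card ≤ T.card + n := by
  induction n with
  | zero => exact ⟨S, h, le_rfl⟩
  | succ n ih =>
    obtain ⟨T, hT, hc⟩ := ih
    set f := derivative^[n] q
    set g := (expDeriv a)^[n] p
    obtain ⟨U, hU, hc'⟩ := exists_deriv_zeros_line (fun x => f.eval x - a ^ x * g.eval x)
      (fun x => (derivative f).eval x - a ^ x * (expDeriv a g).eval x) (fun x => by
        have h1 := (f.hasDerivAt x).sub
          (((hasDerivAt_id x).const_rpow (a := a) (f := fun x => x) ha).mul (g.hasDerivAt x))
        refine HasDerivAt.congr_deriv h1 ?_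
        simp only [expDeriv, eval_add, eval_mul, eval_C]
        ring) T (fun x hx => by rw [hT x hx, sub_self])
    refine ⟨U, fun x hx => ?_, by omega⟩
    rw [Function.iterate_succ_apply', Function.iterate_succ_apply']
    exact sub_eq_zero.1 (hU x hx)

/-- After `d` derivatives `q` is gone, and `a ^ x` times a polynomial of degree less than `e` keeps
at least `e` zeros. So that polynomial vanishes, hence `p`, hence `q`. -/
theorem eq_zero_of_eval_eq {a : ℝ} (ha : 0 < a) (ha1 : a < 1) {S : Finset ℝ} {q p : ℝ[X]}
    {d e : ℕ} (hq : q ∈ degreeLT ℝ d) (hp : p ∈ degreeLT ℝ e) (hS : d + e ≤ S.card)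
    (h : ∀ x ∈ S, q.eval x = a ^ x * p.eval x) : q = 0 ∧ p = 0 := by
  obtain ⟨T, hT, hc⟩ := exists_iterate_deriv_zeros ha q p S h d
  have hlog : Real.log a ≠ 0 := (Real.log_neg ha ha1).ne
  have hder : derivative^[d] q = 0 := by
    rw [mem_degreeLT_iff_coeff] at hq
    ext m
    rw [coeff_iterate_derivative, hq _ (by omega), smul_zero, coeff_zero]
  have hp0 : p = 0 := by
    refine eq_zero_of_iterate_expDeriv_eq_zero hlog d ?_
    refine eq_zero_of_degree_lt_of_eval_finset_eq_zero T ?_ fun x hx => ?_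
    · refine (mem_degreeLT.1 (iterate_expDeriv_mem hp d)).trans_le ?_
      exact_mod_cast (by omega)
    · have := hT x hx
      rw [hder, eval_zero] at this
      exact (mul_eq_zero.1 this.symm).resolve_left (Real.rpow_pos_of_pos ha x).ne'
  refine ⟨?_, hp0⟩
  refine eq_zero_of_degree_lt_of_eval_finset_eq_zero S ?_ fun x hx => by
    rw [h x hx, hp0, eval_zero, mul_zero]
  exact (mem_degreeLT.1 hq).trans_le (by exact_mod_cast (by omega))

/-! ### Rational interpolation of `a ^ x`: existence and signs. -/

/-- The pair `(q, p)` of degrees at most `d` and `i` solves the rational interpolation problem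
`q / p = a ^ x` at the nodes `S`. -/
structure IsInterpolant (a : ℝ) (S : Finset ℝ) (d i : ℕ) (q p : ℝ[X]) : Prop where
  num_mem : q ∈ degreeLT ℝ (d + 1)
  den_mem : p ∈ degreeLT ℝ (i + 1)
  eval_eq : ∀ x ∈ S, q.eval x = a ^ x * p.eval x

variable {a : ℝ} {S : Finset ℝ} {d i : ℕ} {q p q' p' : ℝ[X]}

theorem IsInterpolant.add (h : IsInterpolant a S d i q p) (h' : IsInterpolant a S d i q' p') :
    IsInterpolant a S d i (q + q') (p + p') :=
  ⟨add_mem h.1 h'.1, add_mem h.2 h'.2, fun x hx => by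
    rw [eval_add, eval_add, h.3 x hx, h'.3 x hx, mul_add]⟩

theorem IsInterpolant.smul (h : IsInterpolant a S d i q p) (c : ℝ) :
    IsInterpolant a S d i (c • q) (c • p) :=
  ⟨Submodule.smul_mem _ _ h.1, Submodule.smul_mem _ _ h.2, fun x hx => by
    rw [eval_smul, eval_smul, h.3 x hx, smul_eq_mul, smul_eq_mul]; ring⟩

theorem IsInterpolant.sub (h : IsInterpolant a S d i q p) (h' : IsInterpolant a S d i q' p') :
    IsInterpolant a S d i (q - q') (p - p') := by
  simpa only [neg_smul, one_smul, ← sub_eq_add_neg] using h.add (h'.smul (-1))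

theorem IsInterpolant.mono (h : IsInterpolant a S d i q p) {T : Finset ℝ} (hT : T ⊆ S) {d' i' : ℕ}
    (hd : d ≤ d') (hi : i ≤ i') : IsInterpolant a T d' i' q p :=
  ⟨degreeLT_mono (by omega) h.1, degreeLT_mono (by omega) h.2, fun x hx => h.3 x (hT hx)⟩

/-- The leading coefficients of the two components determine each other. -/
theorem IsInterpolant.exists_coeff_eq (h : IsInterpolant a S d i q p) (ha : 0 < a) (ha1 : a < 1)
    (hS : d + i + 1 ≤ S.card) : ∃ κ : ℝ, 0 < κ ∧ p.coeff i = κ * ((-1) ^ d * q.coeff d) := by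
  obtain ⟨T, hT, hc⟩ := exists_iterate_deriv_zeros ha q p S h.eval_eq d
  rw [iterate_derivative_eq_C h.num_mem] at hT
  -- `d` derivatives have reduced `q` to a constant. Dividing by `a ^ x` exchanges the roles, and
  -- `i` further derivatives reduce the other polynomial to its top coefficient; at least one of the
  -- `d + i + 1` zeros survives.
  obtain ⟨U, hU, hc'⟩ := exists_iterate_deriv_zeros (inv_pos.2 ha) ((expDeriv a)^[d] p)
    (C (d.factorial * q.coeff d)) T (fun x hx => by
      rw [hT x hx, Real.inv_rpow ha.le, inv_mul_cancel_left₀ (Real.rpow_pos_of_pos ha x).ne']) i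
  obtain ⟨z, hz⟩ : U.Nonempty := by rw [← Finset.card_pos]; omega
  have hz := hU z hz
  have hC : (C (d.factorial * q.coeff d) : ℝ[X]) ∈ degreeLT ℝ (0 + 1) := by
    rw [mem_degreeLT]; exact degree_C_le.trans_lt (by norm_num)
  rw [iterate_derivative_eq_C (iterate_expDeriv_mem h.den_mem d), coeff_iterate_expDeriv h.den_mem,
    eq_C_of_degree_le_zero (p := (expDeriv a⁻¹)^[i] _) (Order.lt_succ_iff.1 (by
      have := mem_degreeLT.1 (iterate_expDeriv_mem (a := a⁻¹) hC i)
      exact_mod_cast this)), coeff_iterate_expDeriv hC, eval_C, eval_C, coeff_C_zero,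
    Real.log_inv] at hz
  have hl : 0 < -Real.log a := neg_pos.2 (Real.log_neg ha ha1)
  set l := -Real.log a with hl'
  rw [show Real.log a = -l by rw [hl', neg_neg], neg_pow l] at hz
  have hpow : 0 < a⁻¹ ^ z := Real.rpow_pos_of_pos (inv_pos.2 ha) z
  -- The sign `(-1) ^ d` comes from `log a ^ d`, as `log a = -l` is negative.
  refine ⟨a⁻¹ ^ z * l ^ i * d.factorial / (i.factorial * l ^ d), by positivity, ?_⟩
  have hsq : ((-1 : ℝ) ^ d) * (-1) ^ d = 1 := by rw [← mul_pow]; simp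
  have hi0 : (i.factorial : ℝ) ≠ 0 := by positivity
  rw [div_mul_eq_mul_div, eq_div_iff (by positivity)]
  linear_combination (-1) ^ d * hz - i.factorial * l ^ d * p.coeff i * hsq

theorem mem_degreeLT_of_coeff {n : ℕ} {f : ℝ[X]} (hf : f ∈ degreeLT ℝ (n + 1))
    (h : f.coeff n = 0) : f ∈ degreeLT ℝ n := by
  rw [mem_degreeLT_iff_coeff] at *
  intro m hm
  rcases hm.eq_or_lt with rfl | hm
  · exact h
  · exact hf m hm

/-- A nonzero pair has nonzero leading coefficients. -/
theorem IsInterpolant.eq_zero_of_coeff (h : IsInterpolant a S d i q p) (ha : 0 < a) (ha1 : a < 1)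
    (hS : d + i + 1 ≤ S.card) (h0 : p.coeff i = 0) : q = 0 ∧ p = 0 :=
  eq_zero_of_eval_eq ha ha1 h.1 (mem_degreeLT_of_coeff h.2 h0) (by omega) h.3

/-- There are `d + i + 2` unknown coefficients and `d + i + 1` linear conditions. A nonzero solution
has a nonzero top denominator coefficient, whose sign is free. -/
theorem exists_isInterpolant (ha : 0 < a) (ha1 : a < 1) (hS : S.card = d + i + 1) :
    ∃ q p, IsInterpolant a S d i q p ∧ 0 < p.coeff i := by
  let F : (degreeLT ℝ (d + 1) × degreeLT ℝ (i + 1)) →ₗ[ℝ] (S → ℝ) :=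
    { toFun := fun f x => (f.1 : ℝ[X]).eval (x : ℝ) - a ^ (x : ℝ) * (f.2 : ℝ[X]).eval (x : ℝ)
      map_add' := by intro f g; ext x; simp; ring
      map_smul' := by intro c f; ext x; simp; ring }
  have hfin : ∀ n, Module.finrank ℝ (degreeLT ℝ n) = n := fun n => by
    rw [(degreeLTEquiv ℝ n).finrank_eq]; simp
  have : ∀ n, Module.Finite ℝ (degreeLT ℝ n) := fun n =>
    Module.Finite.equiv (degreeLTEquiv ℝ n).symm
  have hker : LinearMap.ker F ≠ ⊥ := LinearMap.ker_ne_bot_of_finrank_lt (by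
    rw [Module.finrank_prod, hfin, hfin]; simp [hS]; omega)
  obtain ⟨f, hf, hf0⟩ := Submodule.exists_mem_ne_zero_of_ne_bot hker
  have hI : IsInterpolant a S d i f.1 f.2 := ⟨f.1.2, f.2.2, fun x hx => by
    have := congrFun (LinearMap.mem_ker.1 hf) ⟨x, hx⟩
    exact sub_eq_zero.1 this⟩
  have hc : (f.2 : ℝ[X]).coeff i ≠ 0 := fun h => hf0 (by
    obtain ⟨h1, h2⟩ := hI.eq_zero_of_coeff ha ha1 hS.ge h
    exact Prod.ext (Subtype.ext h1) (Subtype.ext h2))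
  rcases hc.lt_or_gt with h | h
  · exact ⟨_, _, hI.smul (-1), by simpa using h⟩
  · exact ⟨_, _, hI, h⟩

theorem IsInterpolant.num_coeff_pos (h : IsInterpolant a S d i q p) (ha : 0 < a) (ha1 : a < 1)
    (hS : d + i + 1 ≤ S.card) (hp : 0 < p.coeff i) : 0 < (-1) ^ d * q.coeff d := by
  obtain ⟨κ, hκ, h1⟩ := h.exists_coeff_eq ha ha1 hS
  rw [h1] at hp
  exact (mul_pos_iff_of_pos_left hκ).1 hp

/-- Induction on both degrees: after a node is dropped, the `(d + 1, i + 1)` interpolant is a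
positive combination of the `(d, i + 1)` and `(d + 1, i)` interpolants on the remaining nodes. If
either degree is `0`, that component is a constant of known sign. -/
theorem IsInterpolant.eval_pos (ha : 0 < a) (ha1 : a < 1) :
    ∀ {d i : ℕ} {S : Finset ℝ} {q p : ℝ[X]}, IsInterpolant a S d i q p → S.card = d + i + 1 →
      0 < p.coeff i → ∀ x ∈ S, 0 < q.eval x := by
  intro d
  induction d with
  | zero =>
    intro i S q p h hS hp x _
    have h1 := h.num_coeff_pos ha ha1 hS.ge hp
    rw [eq_C_of_degree_le_zero (p := q) (Order.lt_succ_iff.1 (by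
      have := mem_degreeLT.1 h.num_mem; exact_mod_cast this)), eval_C]
    simpa using h1
  | succ d ihd =>
    intro i
    induction i with
    | zero =>
      intro S q p h hS hp x hx
      rw [h.eval_eq x hx, eq_C_of_degree_le_zero (p := p) (Order.lt_succ_iff.1 (by
        have := mem_degreeLT.1 h.den_mem; exact_mod_cast this)), eval_C]
      exact mul_pos (Real.rpow_pos_of_pos ha x) hp
    | succ i ihi =>
      intro S q p h hS hp x hx
      obtain ⟨y, hy, hyx⟩ := Finset.exists_mem_ne (by omega : 1 < S.card) x
      have hxS : x ∈ S.erase y := Finset.mem_erase.2 ⟨hyx.symm, hx⟩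
      have hcard : (S.erase y).card = d + i + 2 := by
        rw [Finset.card_erase_of_mem hy, hS]; omega
      obtain ⟨f, g, hA, hA0⟩ := exists_isInterpolant (d := d) (i := i + 1) ha ha1 (by rw [hcard]; ring)
      obtain ⟨f', g', hB, hB0⟩ := exists_isInterpolant (d := d + 1) (i := i) ha ha1 (by rw [hcard]; ring)
      have hqd := h.num_coeff_pos ha ha1 hS.ge hp
      have hBd := hB.num_coeff_pos ha ha1 (by rw [hcard]; omega) hB0
      -- `α` matches the top coefficient of the denominator, to which `g'` does not contribute, and
      -- `β` that of the numerator, to which `f` does not contribute.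
      set α := p.coeff (i + 1) / g.coeff (i + 1) with hα
      set β := ((-1) ^ (d + 1) * q.coeff (d + 1)) / ((-1) ^ (d + 1) * f'.coeff (d + 1)) with hβ
      have hα0 : 0 < α := div_pos hp hA0
      have hβ0 : 0 < β := div_pos hqd hBd
      have hβ' : β * f'.coeff (d + 1) = q.coeff (d + 1) := by
        have h1 := div_mul_cancel₀ ((-1) ^ (d + 1) * q.coeff (d + 1)) hBd.ne'
        rw [← hβ] at h1
        have h2 : ((-1 : ℝ) ^ (d + 1)) * (-1) ^ (d + 1) = 1 := by rw [← mul_pow]; simp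
        linear_combination (-1) ^ (d + 1) * h1 + (q.coeff (d + 1) - β * f'.coeff (d + 1)) * h2
      have hcomb := ((h.mono (Finset.erase_subset y S) le_rfl le_rfl).sub
        ((hA.mono subset_rfl (Nat.le_succ d) le_rfl).smul α)).sub
        ((hB.mono subset_rfl le_rfl (Nat.le_succ i)).smul β)
      have hf0 := mem_degreeLT_iff_coeff.1 hA.num_mem (d + 1) le_rfl
      have hg0 := mem_degreeLT_iff_coeff.1 hB.den_mem (i + 1) le_rfl
      -- With both top coefficients cancelled, the remainder has degrees at most `d` and `i` but `d
      -- + i + 2` nodes, so it is zero.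
      have hz := eq_zero_of_eval_eq ha ha1
        (mem_degreeLT_of_coeff hcomb.num_mem (by simp [hf0, hβ']))
        (mem_degreeLT_of_coeff hcomb.den_mem (by simp [hg0, hα, div_mul_cancel₀ _ hA0.ne']))
        (by rw [hcard]; omega) hcomb.eval_eq
      have hq : q = α • f + β • f' := by
        rw [← sub_eq_zero, ← hz.1]; ring
      have h1 := ihd hA (by rw [hcard]; ring) hA0 x hxS
      have h2 := ihi hB (by rw [hcard]; ring) hB0 x hxS
      rw [hq, eval_add, eval_smul, eval_smul, smul_eq_mul, smul_eq_mul]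
      positivity

/-! ### The Müntz condition and the products over `[0, 1]`. -/

open Filter Topology

/-- The partial sums of the Müntz series are unbounded. -/
theorem tendsto_sum_Ioc (r : ℕ → ℝ) (h0 : r 0 = 0) (hr : StrictMono r)
    (hmuntz : ¬ Summable fun i : ℕ => 1 / r (i + 1)) (J : ℕ) :
    Tendsto (fun m => ∑ l ∈ Finset.Ioc J m, 1 / r l) atTop atTop := by
  have hpos : ∀ i : ℕ, 0 ≤ 1 / r (i + 1) := fun i => by
    have : r 0 < r (i + 1) := hr (Nat.succ_pos i)
    rw [h0] at this
    positivity
  have h1 := (not_summable_iff_tendsto_nat_atTop_of_nonneg hpos).1 hmuntz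
  refine (tendsto_atTop_add_const_right _ (-∑ i ∈ Finset.range J, 1 / r (i + 1)) h1).congr' ?_
  filter_upwards [eventually_ge_atTop J] with m hm
  induction m, hm using Nat.le_induction with
  | base => simp
  | succ m hm ih =>
    rw [Finset.sum_range_succ, Finset.sum_Ioc_succ_top hm, ← ih]; ring

/-- The bounds on `x` and `ε` give `(1 - x) * (1 + (1 + ε) * x) ≥ 1`, and `1 + u ≤ exp u` finishes.
-/
theorem exp_le_one_sub {x ε : ℝ} (hx : 0 ≤ x) (hε : ε ≤ 1) (hxε : x ≤ ε / 2) :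
    Real.exp (-((1 + ε) * x)) ≤ 1 - x := by
  have hx1 : 0 < 1 - x := by linarith
  rw [Real.exp_neg, inv_le_comm₀ (Real.exp_pos _) hx1]
  have h1 := Real.add_one_le_exp ((1 + ε) * x)
  refine le_trans ?_ h1
  rw [inv_le_iff_one_le_mul₀ hx1]
  nlinarith [mul_nonneg hx (by linarith : 0 ≤ ε / 2 - x), mul_nonneg hx (by linarith : 0 ≤ 1 - ε)]

/-- The loss is at most `ε * y * exp (-y)`, and `y * exp (-y) ≤ 1`. -/
theorem exp_sub_le {y ε : ℝ} (hε : 0 ≤ ε) :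
    Real.exp (-y) - ε ≤ Real.exp (-((1 + ε) * y)) := by
  have h1 : Real.exp (-((1 + ε) * y)) = Real.exp (-y) * Real.exp (-(ε * y)) := by
    rw [← Real.exp_add]; ring_nf
  have h2 := Real.add_one_le_exp (-(ε * y))
  have h3 : y * Real.exp (-y) ≤ 1 := by
    rw [Real.exp_neg, ← div_eq_mul_inv, div_le_one (Real.exp_pos _)]
    linarith [Real.add_one_le_exp y]
  have h4 := mul_le_mul_of_nonneg_left h2 (Real.exp_pos (-y)).le
  have h5 := mul_le_mul_of_nonneg_left h3 hε
  rw [h1]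
  nlinarith

/-- The control points over `[0, 1]` of `t ^ r 1` and `t ^ r k` are asymptotically related by a
power. -/
theorem prod_rpow_sub_le (r : ℕ → ℝ) (h0 : r 0 = 0) (hr : StrictMono r)
    (hlim : Tendsto r atTop atTop) (hmuntz : ¬ Summable fun i : ℕ => 1 / r (i + 1))
    (k : ℕ) (hk : 1 ≤ k) {δ : ℝ} (hδ : 0 < δ) :
    ∃ M : ℕ, ∀ m, M ≤ m → k ≤ m → ∀ j,
      (∏ l ∈ Finset.Ioc j m, (1 - r 1 / r l)) ^ (r k / r 1) - δ ≤
        ∏ l ∈ Finset.Ioc j m, (1 - r k / r l) := by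
  have hpos : ∀ l, 1 ≤ l → 0 < r l := fun l hl => by rw [← h0]; exact hr hl
  have hk0 := hpos k hk
  have h10 := hpos 1 le_rfl
  set ε := min δ 1 with hε
  have hε0 : 0 < ε := lt_min hδ one_pos
  -- From `J` on, `r k / r l ≤ ε / 2`, as `exp_le_one_sub` requires. `M` is then such that `exp (-(r
  -- k * ∑ 1 / r l)) ≤ ε`, the sum being over `J < l ≤ m`.
  obtain ⟨J, hJ⟩ := eventually_atTop.1
    ((hlim.eventually_ge_atTop (2 * r k / ε)).and (eventually_ge_atTop k))
  obtain ⟨M, hM⟩ := eventually_atTop.1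
    ((tendsto_sum_Ioc r h0 hr hmuntz J).eventually_ge_atTop (-Real.log ε / r k))
  refine ⟨M, fun m hMm hkm j => ?_⟩
  have hx0 : ∀ l ∈ Finset.Ioc j m, 0 ≤ 1 - r 1 / r l := fun l hl => by
    have hl : 1 ≤ l := by have := (Finset.mem_Ioc.1 hl).1; omega
    rw [sub_nonneg, div_le_one (hpos l hl)]
    exact hr.monotone hl
  have hupper : (∏ l ∈ Finset.Ioc j m, (1 - r 1 / r l)) ^ (r k / r 1) ≤
      Real.exp (-(r k * ∑ l ∈ Finset.Ioc j m, 1 / r l)) := by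
    have h1 : ∏ l ∈ Finset.Ioc j m, (1 - r 1 / r l) ≤
        Real.exp (-(r 1 * ∑ l ∈ Finset.Ioc j m, 1 / r l)) := by
      rw [Finset.mul_sum, ← Finset.sum_neg_distrib, Real.exp_sum]
      refine Finset.prod_le_prod hx0 fun l _ => ?_
      have := Real.add_one_le_exp (-(r 1 * (1 / r l)))
      rw [mul_one_div] at this ⊢
      linarith
    refine (Real.rpow_le_rpow (Finset.prod_nonneg hx0) h1 (by positivity)).trans_eq ?_
    rw [← Real.exp_mul]
    congr 1
    field_simp
  -- For `j < J` the power on the left is at most `δ` and the right side is nonnegative. For `j ≥ J`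
  -- every factor on the right is comparable to an exponential.
  rcases lt_or_ge j J with hj | hj
  · have hy0 : 0 ≤ ∏ l ∈ Finset.Ioc j m, (1 - r k / r l) := by
      rcases lt_or_ge j k with hjk | hjk
      -- Here the factor `l = k` occurs and is zero.
      · rw [Finset.prod_eq_zero (Finset.mem_Ioc.2 ⟨hjk, hkm⟩) (by rw [div_self hk0.ne', sub_self])]
      · refine Finset.prod_nonneg fun l hl => ?_
        have hl : k ≤ l := by have := (Finset.mem_Ioc.1 hl).1; omega
        rw [sub_nonneg, div_le_one (hpos l (hk.trans hl))]
        exact hr.monotone hl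
    have hT : -Real.log ε / r k ≤ ∑ l ∈ Finset.Ioc j m, 1 / r l := by
      refine (hM m hMm).trans (Finset.sum_le_sum_of_subset_of_nonneg
        (Finset.Ioc_subset_Ioc_left hj.le) fun l hl _ => ?_)
      have := hpos l (by have := (Finset.mem_Ioc.1 hl).1; omega)
      positivity
    have h2 : Real.exp (-(r k * ∑ l ∈ Finset.Ioc j m, 1 / r l)) ≤ δ := by
      refine le_trans ?_ (min_le_left δ 1)
      rw [← hε, ← Real.le_log_iff_exp_le hε0]
      rw [div_le_iff₀ hk0] at hT
      linarith
    linarith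
  · have hlower : Real.exp (-((1 + ε) * (r k * ∑ l ∈ Finset.Ioc j m, 1 / r l))) ≤
        ∏ l ∈ Finset.Ioc j m, (1 - r k / r l) := by
      rw [Finset.mul_sum, Finset.mul_sum, ← Finset.sum_neg_distrib, Real.exp_sum]
      refine Finset.prod_le_prod (fun _ _ => (Real.exp_pos _).le) fun l hl => ?_
      have hl : J ≤ l := by have := (Finset.mem_Ioc.1 hl).1; omega
      have hl' := hJ l hl
      have hl0 := hpos l (hk.trans hl'.2)
      rw [mul_one_div]
      refine exp_le_one_sub (div_pos hk0 hl0).le (min_le_right _ _) ?_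
      have := hl'.1
      rw [div_le_iff₀ hε0] at this
      rw [div_le_iff₀ hl0]
      linarith
    have h3 := exp_sub_le (y := r k * ∑ l ∈ Finset.Ioc j m, 1 / r l) hε0.le
    have h4 : ε ≤ δ := min_le_left _ _
    linarith

/-! ### Sign of a function next to a zero of known order. -/

/-- A function whose first nonzero derivative at `a` is positive is positive to the right of `a`. -/
theorem eventually_pos_of_iteratedDeriv_pos {a : ℝ} (ha : 0 < a) (l : ℕ) :
    ∀ f : ℝ → ℝ, ContDiffOn ℝ (⊤ : ℕ∞) f (Set.Ioi 0) → (∀ j < l, iteratedDeriv j f a = 0) →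
      0 < iteratedDeriv l f a → ∀ᶠ t in 𝓝[>] a, 0 < f t := by
  induction l with
  | zero =>
    intro f hf _ hpos
    rw [iteratedDeriv_zero] at hpos
    exact ((hf.contDiffAt (Ioi_mem_nhds ha)).continuousAt.eventually (lt_mem_nhds hpos)).filter_mono
      nhdsWithin_le_nhds
  | succ l ih =>
    intro f hf hz hpos
    have h1 := ih (deriv f) (hf.deriv_of_isOpen isOpen_Ioi (by simp))
      (fun j hj => by rw [← iteratedDeriv_succ']; exact hz (j + 1) (by omega))
      (by rwa [← iteratedDeriv_succ'])
    obtain ⟨b, hab, hb⟩ := mem_nhdsGT_iff_exists_Ioo_subset.1 h1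
    have hmono : StrictMonoOn f (Set.Ico a b) := by
      refine strictMonoOn_of_deriv_pos (convex_Ico a b)
        (hf.continuousOn.mono fun x hx => ha.trans_le hx.1) fun x hx => ?_
      rw [interior_Ico] at hx
      exact hb hx
    have hfa : f a = 0 := by simpa using hz 0 (Nat.succ_pos l)
    filter_upwards [Ioo_mem_nhdsGT hab] with t ht
    rw [← hfa]
    exact hmono ⟨le_rfl, hab⟩ ⟨ht.1.le, ht.2⟩ ht.1

/-! ### Normalized interpolants and their comparison for neighbouring degrees. -/

theorem IsInterpolant.den_coeff_pos (h : IsInterpolant a S d i q p) (ha : 0 < a) (ha1 : a < 1)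
    (hS : S.card = d + i + 1) {x : ℝ} (hx : x ∈ S) (hq : 0 < q.eval x) : 0 < p.coeff i := by
  rcases lt_trichotomy (p.coeff i) 0 with h1 | h1 | h1
  · have := (h.smul (-1)).eval_pos ha ha1 hS (by simpa using h1) x hx
    rw [eval_smul, smul_eq_mul] at this
    linarith
  · rw [(h.eq_zero_of_coeff ha ha1 hS.ge h1).1, eval_zero] at hq
    exact absurd hq (lt_irrefl 0)
  · exact h1

theorem exists_isInterpolant_normalized (ha : 0 < a) (ha1 : a < 1) (hS : S.card = d + i + 1)
    {x : ℝ} (hx : x ∈ S) : ∃ q p, IsInterpolant a S d i q p ∧ q.eval x = 1 := by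
  obtain ⟨q, p, h, hp⟩ := exists_isInterpolant (d := d) (i := i) ha ha1 hS
  have hq := h.eval_pos ha ha1 hS hp x hx
  exact ⟨_, _, h.smul (q.eval x)⁻¹, by rw [eval_smul, smul_eq_mul, inv_mul_cancel₀ hq.ne']⟩

theorem exists_eq_X_sub_C_mul {f : ℝ[X]} {n : ℕ} (hf : f ∈ degreeLT ℝ (n + 1)) {x : ℝ}
    (hx : f.eval x = 0) :
    ∃ g ∈ degreeLT ℝ n, f = (X - C x) * g := by
  obtain ⟨g, rfl⟩ := dvd_iff_isRoot.2 hx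
  refine ⟨g, ?_, rfl⟩
  rcases eq_or_ne g 0 with rfl | hg
  · exact zero_mem _
  rw [mem_degreeLT, degree_mul, degree_X_sub_C, degree_eq_natDegree hg] at hf
  rw [mem_degreeLT, degree_eq_natDegree hg]
  have : 1 + g.natDegree < n + 1 := by exact_mod_cast hf
  exact_mod_cast (by omega : g.natDegree < n)

/-- Dividing out a common zero at a node. -/
theorem IsInterpolant.exists_div (h : IsInterpolant a S (d + 1) (i + 1) q p) (ha : 0 < a) {x : ℝ}
    (hx : x ∈ S) (h0 : q.eval x = 0) :
    ∃ f g, IsInterpolant a (S.erase x) d i f g ∧ q = (X - C x) * f ∧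
      g.coeff i = p.coeff (i + 1) := by
  obtain ⟨f, hf, hqf⟩ := exists_eq_X_sub_C_mul h.num_mem h0
  obtain ⟨g, hg, hpg⟩ := exists_eq_X_sub_C_mul h.den_mem (x := x) (by
    have := h.eval_eq x hx
    rw [h0] at this
    exact (mul_eq_zero.1 this.symm).resolve_left (Real.rpow_pos_of_pos ha x).ne')
  refine ⟨f, g, ⟨hf, hg, fun y hy => ?_⟩, hqf, ?_⟩
  · have := h.eval_eq y (Finset.mem_of_mem_erase hy)
    rw [hqf, hpg, eval_mul, eval_mul, eval_sub, eval_X, eval_C] at this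
    have hne : y - x ≠ 0 := sub_ne_zero.2 (Finset.ne_of_mem_erase hy)
    refine mul_left_cancel₀ hne ?_
    rw [this]; ring
  · rw [hpg, sub_mul, coeff_sub, coeff_X_mul, coeff_C_mul,
      mem_degreeLT_iff_coeff.1 hg (i + 1) le_rfl, mul_zero, sub_zero]

/-- The numerators increase, to the right of the normalization node, when the degree of the
denominator does. -/
theorem IsInterpolant.exists_sub_eq (h : IsInterpolant a S (d + 1) i q p)
    (h' : IsInterpolant a S d (i + 1) q' p') (ha : 0 < a) (ha1 : a < 1) (hS : S.card = d + i + 2)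
    {x : ℝ} (hx : x ∈ S) (hq : q.eval x = 1) (hq' : q'.eval x = 1) :
    ∃ f g, IsInterpolant a (S.erase x) d i f g ∧ q' - q = (X - C x) * f ∧
      ∀ y ∈ S.erase x, 0 < f.eval y := by
  have hp' := h'.den_coeff_pos ha ha1 (by omega) hx (by rw [hq']; exact one_pos)
  -- The difference of the two normalized pairs vanishes at `x`. Dividing by `X - C x` leaves a `(d,
  -- i)` interpolant on the other `d + i + 1` nodes; its top denominator coefficient is that of
  -- `p'`, since `p` has degree at most `i`.
  obtain ⟨f, g, hfg, h1, h2⟩ := ((h'.mono subset_rfl (Nat.le_succ d) le_rfl).sub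
    (h.mono subset_rfl le_rfl (Nat.le_succ i))).exists_div ha hx
    (by rw [eval_sub, hq, hq', sub_self])
  refine ⟨f, g, hfg, h1, hfg.eval_pos ha ha1 ?_ ?_⟩
  · rw [Finset.card_erase_of_mem hx]; omega
  · rw [h2, coeff_sub, mem_degreeLT_iff_coeff.1 h.den_mem (i + 1) le_rfl, sub_zero]
    exact hp'

/-! ### Subdivision weights relative to `[0, 1]`. -/

/-- The first `n + 1` exponents. -/
noncomputable def nodes (r : ℕ → ℝ) (n : ℕ) : Finset ℝ := (Finset.range (n + 1)).image r

variable {r : ℕ → ℝ} {n : ℕ}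

theorem mem_nodes {j : ℕ} (hj : j ≤ n) : r j ∈ nodes r n :=
  Finset.mem_image_of_mem r (Finset.mem_range.2 (Nat.lt_succ_of_le hj))

theorem card_nodes (hr : StrictMono r) : (nodes r n).card = n + 1 := by
  rw [nodes, Finset.card_image_of_injective _ hr.injective, Finset.card_range]

theorem nodes_succ_erase (hr : StrictMono r) : (nodes r (n + 1)).erase (r (n + 1)) = nodes r n := by
  rw [nodes, nodes, Finset.range_add_one (n := n + 1), Finset.image_insert, Finset.erase_insert]
  intro h
  obtain ⟨j, hj, hj'⟩ := Finset.mem_image.1 h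
  rw [hr.injective hj', Finset.mem_range] at hj
  exact lt_irrefl _ hj

/-- Subdivision: the numerator is, at the nodes, a nonnegative combination of the control points
over `[0, 1]`. -/
theorem IsInterpolant.exists_weights (h0 : r 0 = 0) (hr : StrictMono r) (ha : 0 < a)
    (ha1 : a < 1) : ∀ (d i : ℕ) (q p : ℝ[X]), IsInterpolant a (nodes r (d + i)) d i q p →
      q.eval 0 = 1 → ∃ w : ℕ → ℝ, (∀ j, 0 ≤ w j) ∧ ∀ x ≤ d + i,
        q.eval (r x) =
          ∑ j ∈ Finset.range (d + i + 1), w j * ∏ l ∈ Finset.Ioc j (d + i), (1 - r x / r l) := by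
  intro d
  induction d with
  | zero =>
    intro i q p h hq
    -- For `d = 0` the numerator is the constant `1`, which is the empty product at `j = i`.
    refine ⟨Pi.single i 1, fun j => ?_, fun x _ => ?_⟩
    · rw [Pi.single_apply]; split_ifs <;> norm_num
    · rw [eq_C_of_degree_le_zero (p := q) (Order.lt_succ_iff.1 (by
        have := mem_degreeLT.1 h.num_mem; exact_mod_cast this)), eval_C] at hq ⊢
      rw [hq, zero_add, Finset.sum_eq_single i]
      · simp
      · intro j _ hj; rw [Pi.single_eq_of_ne hj, zero_mul]
      · simp
  | succ d ih =>
    intro i q p h hq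
    have hn : d + 1 + i = (d + i) + 1 := by ring
    rw [hn] at h ⊢
    set n := d + i with hn'
    have h0n : (0 : ℝ) ∈ nodes r (n + 1) := h0 ▸ mem_nodes (Nat.zero_le _)
    have hrn : r (n + 1) ∈ nodes r (n + 1) := mem_nodes le_rfl
    have hpos : 0 < r (n + 1) := by rw [← h0]; exact hr (Nat.succ_pos n)
    have hcard : (nodes r (n + 1)).card = d + i + 2 := by rw [card_nodes hr]
    obtain ⟨q', p', h', hq'⟩ := exists_isInterpolant_normalized (S := nodes r (n + 1)) (d := d)
      (i := i + 1) ha ha1 (by rw [hcard]; ring) h0n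
    obtain ⟨w', hw', hw'e⟩ := ih (i + 1) q' p' h' hq'
    obtain ⟨f, _, _, hf, hfpos⟩ := h.exists_sub_eq h' ha ha1 hcard h0n hq hq'
    have hlt : q.eval (r (n + 1)) < q'.eval (r (n + 1)) := by
      have h1 := hfpos (r (n + 1)) (Finset.mem_erase.2 ⟨hpos.ne', hrn⟩)
      have h2 := congrArg (eval (r (n + 1))) hf
      rw [eval_sub, eval_mul, eval_sub, eval_X, eval_C, sub_zero] at h2
      have := mul_pos hpos h1
      linarith
    have hqpos : 0 < q.eval (r (n + 1)) := h.eval_pos ha ha1 (by rw [hcard]; ring)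
      (h.den_coeff_pos ha ha1 (by rw [hcard]; ring) h0n (by rw [hq]; exact one_pos)) _ hrn
    -- `β` makes `q - β * q'` vanish at the last node. The quotient `f` is an interpolant on one
    -- node fewer, and evaluation at `0` gives `q = β * q' + (1 - β) * (1 - x / r (n + 1)) * (f /
    -- f(0))`. Since numerators grow with the denominator degree, `0 < β < 1`.
    set β := q.eval (r (n + 1)) / q'.eval (r (n + 1)) with hβ
    have hβ0 : 0 < β := div_pos hqpos (hqpos.trans hlt)
    have hβ1 : β < 1 := (div_lt_one (hqpos.trans hlt)).2 hlt
    obtain ⟨f, g, hfg, hf, -⟩ := ((h.mono subset_rfl le_rfl (Nat.le_succ i)).sub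
      ((h'.mono subset_rfl (Nat.le_succ d) le_rfl).smul β)).exists_div ha hrn (by
        rw [eval_sub, eval_smul, smul_eq_mul, hβ, div_mul_cancel₀ _ (hqpos.trans hlt).ne',
          sub_self])
    rw [nodes_succ_erase hr] at hfg
    have hf0 : -r (n + 1) * f.eval 0 = 1 - β := by
      have h2 := congrArg (eval 0) hf
      rw [eval_sub, eval_mul, eval_sub, eval_X, eval_C, zero_sub, eval_smul, hq, hq',
        smul_eq_mul, mul_one] at h2
      exact h2.symm
    have hf0' : f.eval 0 = -((1 - β) / r (n + 1)) := by
      rw [← hf0]; field_simp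
    have hf0ne : f.eval 0 ≠ 0 := by
      rw [hf0', neg_ne_zero]
      exact (div_pos (by linarith) hpos).ne'
    obtain ⟨w, hw, hwe⟩ := ih i _ _ (hfg.smul (f.eval 0)⁻¹)
      (by rw [eval_smul, smul_eq_mul, inv_mul_cancel₀ hf0ne])
    -- The sum for `f` stops at `j = n`; the index `n + 1` belongs to `q'` alone.
    refine ⟨fun j => β * w' j + if j < n + 1 then (1 - β) * w j else 0, fun j => ?_,
      fun x hx => ?_⟩
    · have h1 := mul_nonneg hβ0.le (hw' j)
      have h2 := mul_nonneg (sub_nonneg.2 hβ1.le) (hw j)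
      dsimp only
      split_ifs <;> linarith
    · have hsum : ∑ j ∈ Finset.range (n + 1 + 1), (if j < n + 1 then (1 - β) * w j else 0) *
          ∏ l ∈ Finset.Ioc j (n + 1), (1 - r x / r l) = (1 - β) * (1 - r x / r (n + 1)) *
          ∑ j ∈ Finset.range (n + 1), w j * ∏ l ∈ Finset.Ioc j n, (1 - r x / r l) := by
        rw [Finset.sum_range_succ, if_neg (lt_irrefl _), zero_mul, add_zero, Finset.mul_sum]
        refine Finset.sum_congr rfl fun j hj => ?_
        have hj := Finset.mem_range.1 hj
        rw [if_pos hj, Finset.prod_Ioc_succ_top (by omega)]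
        ring
      have hq'x := hw'e x (by omega)
      rw [show d + (i + 1) = n + 1 by omega] at hq'x
      have hqx : q.eval (r x) = β * q'.eval (r x) + (r x - r (n + 1)) * f.eval (r x) := by
        have h2 := congrArg (eval (r x)) hf
        rw [eval_sub, eval_mul, eval_sub, eval_X, eval_C, eval_smul, smul_eq_mul] at h2
        linarith
      have hrest : (r x - r (n + 1)) * f.eval (r x) = (1 - β) * (1 - r x / r (n + 1)) *
          ∑ j ∈ Finset.range (n + 1), w j * ∏ l ∈ Finset.Ioc j n, (1 - r x / r l) := by
        -- The expansion of `f` is known only at the first `n + 1` nodes; at the last one the factor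
        -- `1 - r x / r (n + 1)` vanishes.
        rcases hx.eq_or_lt with rfl | hx
        · rw [div_self hpos.ne']; ring
        · rw [← hwe x (by omega), eval_smul, smul_eq_mul, ← hf0]
          field_simp
          ring
      simp only [add_mul, Finset.sum_add_distrib]
      rw [hsum, hqx, hrest, hq'x, Finset.mul_sum]
      simp only [mul_assoc]

/-! ### Convexity of the control polygon. -/

/-- The sequence `v` is a convex function of the increasing sequence `u`. -/
theorem exists_subgradient {u v : ℕ → ℝ} {m : ℕ} (hu : ∀ s < m, u s < u (s + 1))
    (hv : ∀ s, s + 1 < m → (v (s + 1) - v s) / (u (s + 1) - u s) ≤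
      (v (s + 2) - v (s + 1)) / (u (s + 2) - u (s + 1))) {i : ℕ} (hi : i < m) :
    ∃ σ : ℝ, ∀ j ≤ m, v i + σ * (u j - u i) ≤ v j := by
  set σ : ℕ → ℝ := fun s => (v (s + 1) - v s) / (u (s + 1) - u s) with hσ
  have hstep : ∀ s < m, v (s + 1) - v s = σ s * (u (s + 1) - u s) := fun s hs =>
    (div_mul_cancel₀ _ (sub_pos.2 (hu s hs)).ne').symm
  have hmono : ∀ s t, s ≤ t → t < m → σ s ≤ σ t := by
    intro s t hst
    induction t, hst using Nat.le_induction with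
    | base => exact fun _ => le_rfl
    | succ t _ ih => exact fun ht => (ih (by omega)).trans (hv t ht)
  -- The slope of the edge leaving vertex `i` serves as subgradient: later edges are at least as
  -- steep, earlier ones at most.
  refine ⟨σ i, fun j hj => ?_⟩
  rcases le_total i j with hij | hij
  · induction j, hij using Nat.le_induction with
    | base => simp
    | succ j hij ih =>
      have h1 := ih (by omega)
      have h2 := hstep j (by omega)
      have h3 := mul_le_mul_of_nonneg_right (hmono i j hij (by omega))
        (sub_pos.2 (hu j (by omega))).le
      linarith
  · induction hij using Nat.decreasingInduction with
    | self => simp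
    | of_succ j hij ih =>
      have h1 := ih (by omega)
      have h2 := hstep j (by omega)
      have h3 := mul_le_mul_of_nonneg_right (hmono j i (by omega) hi)
        (sub_pos.2 (hu j (by omega))).le
      linarith

/-- The values of the normalized numerators at two nodes form an increasing convex polygon. -/
theorem polygon_convex (h0 : r 0 = 0) (hr : StrictMono r) (ha : 0 < a) (ha1 : a < 1) {m k : ℕ}
    (hk : 1 < k) (hkm : k ≤ m) (Q P : ℕ → ℝ[X])
    (hQ : ∀ s ≤ m, IsInterpolant a (nodes r m) (m - s) s (Q s) (P s) ∧ (Q s).eval 0 = 1) :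
    (∀ s < m, (Q s).eval (r 1) < (Q (s + 1)).eval (r 1)) ∧
    ∀ s, s + 1 < m →
      ((Q (s + 1)).eval (r k) - (Q s).eval (r k)) / ((Q (s + 1)).eval (r 1) - (Q s).eval (r 1)) ≤
      ((Q (s + 2)).eval (r k) - (Q (s + 1)).eval (r k)) /
        ((Q (s + 2)).eval (r 1) - (Q (s + 1)).eval (r 1)) := by
  have h0n : (0 : ℝ) ∈ nodes r m := h0 ▸ mem_nodes (Nat.zero_le _)
  have hr1 : 0 < r 1 := by rw [← h0]; exact hr one_pos
  have hrk : r 1 < r k := hr hk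
  have h1n : r 1 ∈ (nodes r m).erase 0 := Finset.mem_erase.2 ⟨hr1.ne', mem_nodes (by omega)⟩
  have hkn : r k ∈ (nodes r m).erase 0 :=
    Finset.mem_erase.2 ⟨(hr1.trans hrk).ne', mem_nodes hkm⟩
  -- Consecutive numerators differ by `X * F s`, so the edge slopes are `r k * F s (r k) / (r 1 * F
  -- s (r 1))`, and each `F s` is again an interpolant, on the nodes without `0`.
  have hF : ∀ s, s < m → ∃ f g, IsInterpolant a ((nodes r m).erase 0) (m - s - 1) s f g ∧
      Q (s + 1) - Q s = (X - C 0) * f ∧ ∀ y ∈ (nodes r m).erase 0, 0 < f.eval y := by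
    intro s hs
    have h1 := hQ s hs.le
    have h2 := hQ (s + 1) hs
    obtain ⟨d, hd⟩ : ∃ d, m = d + s + 1 := ⟨m - s - 1, by omega⟩
    rw [show m - s = d + 1 by omega] at h1 ⊢
    rw [show m - (s + 1) = d by omega] at h2
    exact h1.1.exists_sub_eq h2.1 ha ha1 (by rw [card_nodes hr]; omega) h0n h1.2 h2.2
  choose! F G hFG hdiff hpos using hF
  have hval : ∀ s < m, ∀ x, (Q (s + 1)).eval x - (Q s).eval x = x * (F s).eval x := by
    intro s hs x
    rw [← eval_sub, hdiff s hs, eval_mul, eval_sub, eval_X, eval_C, sub_zero]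
  refine ⟨fun s hs => ?_, fun s hs => ?_⟩
  · have h1 := hval s hs (r 1)
    have h2 := mul_pos hr1 (hpos s hs _ h1n)
    linarith
  · have hs' : s < m := by omega
    have hp1 := hpos s hs' _ h1n
    have hp2 := hpos (s + 1) hs _ h1n
    obtain ⟨d, hd⟩ : ∃ d, m = d + s + 2 := ⟨m - s - 2, by omega⟩
    have hI1 := (hFG s hs').smul ((F s).eval (r 1))⁻¹
    have hI2 := (hFG (s + 1) hs).smul ((F (s + 1)).eval (r 1))⁻¹
    rw [show m - s - 1 = d + 1 by omega] at hI1
    rw [show m - (s + 1) - 1 = d by omega] at hI2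
    -- The same comparison, one level down and normalized at `r 1`, shows that `F s (r k) / F s (r
    -- 1)` increases with `s`.
    obtain ⟨f, _, _, hf, hfpos⟩ := hI1.exists_sub_eq hI2 ha ha1
      (by rw [Finset.card_erase_of_mem h0n, card_nodes hr]; omega) h1n
      (by rw [eval_smul, smul_eq_mul, inv_mul_cancel₀ hp1.ne'])
      (by rw [eval_smul, smul_eq_mul, inv_mul_cancel₀ hp2.ne'])
    have h3 := congrArg (eval (r k)) hf
    rw [eval_sub, eval_mul, eval_sub, eval_X, eval_C, eval_smul, eval_smul, smul_eq_mul,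
      smul_eq_mul] at h3
    have h4 := mul_pos (sub_pos.2 hrk) (hfpos (r k) (Finset.mem_erase.2 ⟨hrk.ne', hkn⟩))
    rw [hval s hs', hval s hs', hval (s + 1) hs, hval (s + 1) hs, mul_div_mul_comm, mul_div_mul_comm]
    refine mul_le_mul_of_nonneg_left ?_ (div_pos (hr1.trans hrk) hr1).le
    rw [div_eq_inv_mul, div_eq_inv_mul]
    linarith

/-! ### Control points as values of interpolants. -/

variable {m : ℕ}

/-- A linear functional on the Müntz space is given by its values on the powers. -/
theorem exists_functional (hr : StrictMono r) (φ : Fin (m + 1) → ℝ) :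
    ∃ F : MuntzSpace r m →ₗ[ℝ] ℝ, ∀ (f : MuntzSpace r m) (c : Fin (m + 1) → ℝ),
      powerSum r m c = f → F f = ∑ x, c x * φ x := by
  let b : Module.Basis (Fin (m + 1)) ℝ (MuntzSpace r m) :=
    Module.Basis.span (linearIndependent_powers (n := m) hr)
  have hb : ∀ x t, (b x : ℝ → ℝ) t = t ^ r x := fun x t => by
    have h : (b x : ℝ → ℝ) = fun t => t ^ r x :=
      congrArg Subtype.val (Module.Basis.span_apply (linearIndependent_powers (n := m) hr) x)
    rw [h]
  refine ⟨b.constr ℝ φ, fun f c hc => ?_⟩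
  have hf : f = ∑ x, c x • b x := by
    apply Subtype.ext
    rw [← hc]
    ext t
    simp [hb, powerSum]
  rw [hf, map_sum]
  simp

theorem powerSum_single {j : ℕ} (hj : j ≤ m) :
    powerSum r m (Pi.single ⟨j, Nat.lt_succ_of_le hj⟩ 1) = (muntzPower r hj : ℝ → ℝ) := by
  ext t
  rw [powerSum, Finset.sum_eq_single ⟨j, Nat.lt_succ_of_le hj⟩]
  · simp [muntzPower]
  · intro x _ hx; rw [Pi.single_eq_of_ne hx, zero_mul]
  · simp

/-- The control points of the powers are the values at the exponents of the numerator of a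
rational interpolant of `a ^ x`. -/
theorem controlPoint_muntzPower (h0 : r 0 = 0) (hr : StrictMono r) (ha : 0 < a) (ha1 : a < 1)
    {q p : ℝ[X]} (i : Fin (m + 1)) (h : IsInterpolant a (nodes r m) (m - i) i q p)
    (hq : q.eval 0 = 1) {j : ℕ} (hj : j ≤ m) :
    controlPoint h0 hr ha ha1 (muntzPower r hj) i = q.eval (r j) := by
  set B := chebyshevBernsteinBasis h0 hr ha ha1 m with hBdef
  have hB : IsChebyshevBernsteinBasis a 1 B := isChebyshevBernsteinBasis h0 hr ha ha1 m
  obtain ⟨F, hF⟩ := exists_functional (m := m) hr fun x => q.eval (r x)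
  have hpow : ∀ {j : ℕ} (hj : j ≤ m), F (muntzPower r hj) = q.eval (r j) := by
    intro j hj
    rw [hF _ _ (powerSum_single hj), Finset.sum_eq_single ⟨j, Nat.lt_succ_of_le hj⟩]
    · simp
    · intro x _ hx; rw [Pi.single_eq_of_ne hx, zero_mul]
    · simp
  have hne : ∀ l, l ≠ i → F (B l) = 0 := by
    intro l hl
    obtain ⟨c, hc⟩ := mem_muntzSpace_iff.1 (B l).2
    have hza := (hB.1 l).1.1
    have hzb := (hB.1 l).2.1
    rw [← hc] at hza hzb
    rw [hF _ _ hc]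
    -- For `l < i` the `m - l` zeros at `1` exceed the degree of `q`. For `l > i` the `l` zeros at
    -- `a` exceed the degree of `p`, and the interpolation conditions turn `q` into `a ^ x * p`.
    rcases lt_or_gt_of_ne hl with hlt | hgt
    · have hlt' : (l : ℕ) < i := hlt
      have := sum_eval_eq_zero c one_pos _ hzb q
        (mem_degreeLT.1 (degreeLT_mono (by omega) h.num_mem))
      simpa using this
    · have hgt' : (i : ℕ) < l := hgt
      have := sum_eval_eq_zero c ha _ hza p
        (mem_degreeLT.1 (degreeLT_mono (by omega) h.den_mem))
      rw [← this]
      refine Finset.sum_congr rfl fun x _ => ?_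
      rw [h.eval_eq _ (mem_nodes (Nat.lt_succ_iff.1 x.2))]; ring
  have hrepr : ∀ f, F f = B.repr f i * F (B i) := by
    intro f
    conv_lhs => rw [← B.sum_repr f, map_sum]
    rw [Finset.sum_eq_single i]
    · rw [map_smul, smul_eq_mul]
    · intro l _ hl; rw [map_smul, hne l hl, smul_zero]
    · simp
  have hone : muntzPower r (Nat.zero_le m) = ∑ l, B l := by
    apply Subtype.ext
    ext t
    have := hB.2 t
    simp [muntzPower, h0, this]
  -- The normalizations `∑ l, B l = 1` and `q(0) = 1` correspond to each other.
  have hBi : F (B i) = 1 := by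
    have h1 := hpow (Nat.zero_le m)
    rw [hone, map_sum, Finset.sum_eq_single i (fun l _ hl => hne l hl) (by simp), h0, hq] at h1
    exact h1
  rw [← hpow hj, hrepr, hBi, mul_one, controlPoint, hBdef]

/-! ### Positivity of the Chebyshev-Bernstein basis. -/

theorem contDiffOn_of_mem {f : ℝ → ℝ} (hf : f ∈ MuntzSpace r m) (n : WithTop ℕ∞) :
    ContDiffOn ℝ n f (Set.Ioi 0) := fun _ hx => (contDiffAt_of_mem hf hx n).contDiffWithinAt

/-- The Chebyshev-Bernstein basis functions are positive inside the interval. -/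
theorem chebyshevBernsteinBasis_pos (h0 : r 0 = 0) (hr : StrictMono r) (ha : 0 < a) (ha1 : a < 1)
    (l : Fin (m + 1)) {t : ℝ} (ht : t ∈ Set.Ioo a 1) :
    0 < (chebyshevBernsteinBasis h0 hr ha ha1 m l : ℝ → ℝ) t := by
  set B := chebyshevBernsteinBasis h0 hr ha ha1 m with hBdef
  have hB : IsChebyshevBernsteinBasis a 1 B := isChebyshevBernsteinBasis h0 hr ha ha1 m
  have h0n : (0 : ℝ) ∈ nodes r m := h0 ▸ mem_nodes (Nat.zero_le _)
  have hder : 0 < iteratedDeriv l (B l : ℝ → ℝ) a := by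
    choose Q P hI hQ using fun i : Fin (m + 1) =>
      exists_isInterpolant_normalized (S := nodes r m) (d := m - i) (i := i) ha ha1
        (by rw [card_nodes hr]; omega) h0n
    -- Apply `t ^ l * (d/dt) ^ l` at `a` to `t ^ r j = ∑ i, Q i (r j) * B i` and divide by `a ^ r
    -- j`: this turns `Q i` into `P i`, and the terms `i > l` drop out. Both sides have degree at
    -- most `m` and agree at `m + 1` nodes.
    have hsum : descPochhammer ℝ l =
        ∑ i, (a ^ (l : ℕ) * iteratedDeriv l (B i : ℝ → ℝ) a) • if i ≤ l then P i else 0 := by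
      refine eq_of_degree_sub_lt_of_eval_finset_eq (nodes r m) ?_ fun x hx => ?_
      · rw [card_nodes hr, ← mem_degreeLT]
        refine Submodule.sub_mem _ ?_ (Submodule.sum_mem _ fun i _ => Submodule.smul_mem _ _ ?_)
        · rw [mem_degreeLT, degree_eq_natDegree (monic_descPochhammer ℝ l).ne_zero,
            descPochhammer_natDegree]
          exact_mod_cast l.2
        · split_ifs with hil
          · exact degreeLT_mono (by omega) (hI i).den_mem
          · exact zero_mem _
      · obtain ⟨j, hj, rfl⟩ := Finset.mem_image.1 hx
        have hj : j ≤ m := Nat.lt_succ_iff.1 (Finset.mem_range.1 hj)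
        have h1 := iteratedDeriv_powerSum (r := r) (n := m)
          (Pi.single ⟨j, Nat.lt_succ_of_le hj⟩ 1) ha l
        rw [Finset.sum_eq_single ⟨j, Nat.lt_succ_of_le hj⟩
          (fun x _ hx => by rw [Pi.single_eq_of_ne hx, zero_mul, zero_mul]) (by simp),
          powerSum_single hj, ← B.sum_repr (muntzPower r hj),
          iteratedDeriv_sum_smul _ _ _ ha, Finset.mul_sum, Pi.single_eq_same, one_mul] at h1
        have hap : 0 < a ^ r j := Real.rpow_pos_of_pos ha _
        rw [← mul_right_cancel_iff_of_pos hap, ← h1, eval_finsetSum, Finset.sum_mul]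
        refine Finset.sum_congr rfl fun i _ => ?_
        have h2 := controlPoint_muntzPower h0 hr ha ha1 i (hI i) (hQ i) hj
        rw [controlPoint, ← hBdef] at h2
        rw [h2, (hI i).eval_eq _ hx]
        split_ifs with hil
        · rw [eval_smul, smul_eq_mul]; ring
        · rw [(hB.1 i).1.1 l (not_le.1 hil)]; simp
    -- In degree `l` only `P l` contributes, and its top coefficient is positive.
    have hcoeff := congrArg (fun f => coeff f l) hsum
    have hmonic : (descPochhammer ℝ l).coeff l = 1 := by
      have := monic_descPochhammer ℝ l
      rwa [Monic, leadingCoeff, descPochhammer_natDegree] at this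
    rw [hmonic, finsetSum_coeff, Finset.sum_eq_single l] at hcoeff
    · rw [coeff_smul, smul_eq_mul, if_pos le_rfl] at hcoeff
      have hP := (hI l).den_coeff_pos ha ha1 (by rw [card_nodes hr]; omega) h0n
        (by rw [hQ]; exact one_pos)
      have h1 : 0 < a ^ (l : ℕ) * iteratedDeriv l (B l : ℝ → ℝ) a :=
        pos_of_mul_pos_left (by rw [← hcoeff]; exact one_pos) hP.le
      exact (mul_pos_iff_of_pos_left (pow_pos ha _)).1 h1
    · intro i _ hi
      rw [coeff_smul]
      split_ifs with hil
      · have : (i : ℕ) < l := lt_of_le_of_ne hil (fun h => hi (Fin.ext h))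
        rw [mem_degreeLT_iff_coeff.1 (hI i).den_mem l this, smul_zero]
      · rw [coeff_zero, smul_zero]
    · simp
  have hcont := contDiffOn_of_mem (B l).2
  -- An interior zero would raise the number of zeros to `m + 1`. So the sign on the interval is the
  -- one just to the right of `a`.
  have hne : ∀ z ∈ Set.Ioo a 1, (B l : ℝ → ℝ) z ≠ 0 := by
    intro z hz hzero
    obtain ⟨c, hc⟩ := mem_muntzSpace_iff.1 (B l).2
    have hza := (hB.1 l).1.1
    have hzb := (hB.1 l).2.1
    have hne := (hB.1 l).1.2
    rw [← hc] at hza hzb hne hzero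
    have hc0 := coeff_eq_zero_of_zeros (fun i : Fin (m + 1) => r i) ha ha1 Finset.univ
      (injective_exponents hr).injOn c l (m - l) {z}
      (fun x hx => by
        rw [Finset.mem_singleton] at hx; subst hx
        exact ⟨hz.1, hz.2, hzero⟩)
      (sum_eval_eq_zero c ha _ hza) (sum_eval_eq_zero c one_pos _ hzb)
      (by rw [Finset.card_fin, Finset.card_singleton]; omega)
    apply hne
    have : c = 0 := funext fun i => hc0 i (Finset.mem_univ _)
    have hzero' : powerSum r m c = fun _ => 0 := by ext t; simp [this, powerSum]
    rw [hzero']; simp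
  obtain ⟨s, hs, hs0⟩ := ((eventually_pos_of_iteratedDeriv_pos ha l _ (hcont _) (hB.1 l).1.1
    hder).and (Ioo_mem_nhdsGT ha1)).exists
  by_contra! hle
  have hconn : IsPreconnected (Set.Ioo a 1) := isPreconnected_Ioo
  have hco : ContinuousOn (B l : ℝ → ℝ) (Set.Ioo a 1) :=
    (hcont 0).continuousOn.mono fun x hx => ha.trans hx.1
  obtain ⟨z, hz, hz0⟩ := hconn.intermediate_value ht hs0 hco ⟨hle, hs.le⟩
  exact hne z hz hz0

/-! ### The two inequalities between control points. -/

/-- Jensen's inequality for the control polygon of the curve `(t ^ r 1, t ^ r k)`. -/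
theorem controlPoint_le_rpow (h0 : r 0 = 0) (hr : StrictMono r) (ha : 0 < a) (ha1 : a < 1) {k : ℕ}
    (hk : 1 ≤ k) (hkm : k ≤ m) (i : Fin (m + 1)) :
    controlPoint h0 hr ha ha1 (muntzPower r hkm) i ≤
      controlPoint h0 hr ha ha1 (muntzPower r (hk.trans hkm)) i ^ (r k / r 1) := by
  have h0n : (0 : ℝ) ∈ nodes r m := h0 ▸ mem_nodes (Nat.zero_le _)
  have hr1 : 0 < r 1 := by rw [← h0]; exact hr one_pos
  rcases hk.eq_or_lt with rfl | hk1
  · rw [div_self hr1.ne', Real.rpow_one]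
  have hex : ∀ s, s ≤ m → ∃ q p, IsInterpolant a (nodes r m) (m - s) s q p ∧ q.eval 0 = 1 :=
    fun s hs => exists_isInterpolant_normalized ha ha1 (by rw [card_nodes hr]; omega) h0n
  choose! Q P hQ using hex
  have hlink : ∀ (l : Fin (m + 1)) {j : ℕ} (hj : j ≤ m),
      controlPoint h0 hr ha ha1 (muntzPower r hj) l = (Q l).eval (r j) := fun l j hj =>
    controlPoint_muntzPower h0 hr ha ha1 l (hQ l (by omega)).1 (hQ l (by omega)).2 hj
  rw [hlink, hlink]
  have constant : ∀ f : ℝ[X], f ∈ degreeLT ℝ (0 + 1) → ∀ x y, f.eval x = f.eval y := by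
    intro f hf x y
    rw [eq_C_of_degree_le_zero (p := f) (Order.lt_succ_iff.1 (by
      have := mem_degreeLT.1 hf; exact_mod_cast this)), eval_C, eval_C]
  have hlast : ∀ x, (Q m).eval x = 1 := by
    intro x
    have h1 := hQ m le_rfl
    rw [Nat.sub_self] at h1
    rw [constant _ h1.1.num_mem x 0, h1.2]
  have hfirst : ∀ j ≤ m, (Q 0).eval (r j) = a ^ r j := by
    intro j hj
    have h1 := hQ 0 (Nat.zero_le _)
    have h2 := h1.1.eval_eq 0 h0n
    rw [h1.2, Real.rpow_zero, one_mul] at h2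
    rw [h1.1.eval_eq _ (mem_nodes hj), constant _ h1.1.den_mem _ 0, ← h2, mul_one]
  -- The end vertices lie on the curve, at `t = a` and `t = 1`, outside the open interval where the
  -- basis is positive.
  rcases Nat.eq_zero_or_pos i with hi0 | hi0
  · rw [hi0, hfirst k hkm, hfirst 1 (by omega), ← Real.rpow_mul ha.le, mul_div_cancel₀ _ hr1.ne']
  rcases (Nat.lt_succ_iff.1 i.2).eq_or_lt with him | him
  · rw [him, hlast, hlast, Real.one_rpow]
  obtain ⟨hu, hv⟩ := polygon_convex h0 hr ha ha1 hk1 hkm Q P hQ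
  obtain ⟨σ, hσ⟩ := exists_subgradient (u := fun s => (Q s).eval (r 1))
    (v := fun s => (Q s).eval (r k)) hu hv him
  have hmono : ∀ s t, s ≤ t → t ≤ m → (Q s).eval (r 1) ≤ (Q t).eval (r 1) := by
    intro s t hst
    induction t, hst using Nat.le_induction with
    | base => exact fun _ => le_rfl
    | succ t _ ih => exact fun ht => (ih (by omega)).trans (hu t ht).le
  set x := (Q i).eval (r 1) with hx
  have hx0 : a ^ r 1 < x := by
    rw [← hfirst 1 (by omega)]
    exact (hu 0 (by omega)).trans_le (hmono 1 i hi0 him.le)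
  have hx1 : x < 1 := by
    rw [← hlast (r 1)]
    exact (hu i him).trans_le (hmono _ m him le_rfl)
  have hxpos : 0 < x := (Real.rpow_pos_of_pos ha _).trans hx0
  -- The parameter at which the curve has the abscissa of vertex `i`.
  set t := x ^ (r 1)⁻¹ with ht
  have htx : ∀ j, t ^ r j = x ^ (r j / r 1) := fun j => by
    rw [ht, ← Real.rpow_mul hxpos.le, div_eq_inv_mul]
  have htI : t ∈ Set.Ioo a 1 := by
    refine ⟨?_, Real.rpow_lt_one hxpos.le hx1 (inv_pos.2 hr1)⟩
    have := Real.rpow_lt_rpow (Real.rpow_pos_of_pos ha _).le hx0 (inv_pos.2 hr1)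
    rwa [← Real.rpow_mul ha.le, mul_inv_cancel₀ hr1.ne', Real.rpow_one] at this
  set B := chebyshevBernsteinBasis h0 hr ha ha1 m with hBdef
  have hB : IsChebyshevBernsteinBasis a 1 B := isChebyshevBernsteinBasis h0 hr ha ha1 m
  have hsum : ∀ j ≤ m, ∑ l, (B l : ℝ → ℝ) t * (Q l).eval (r j) = x ^ (r j / r 1) := by
    intro j hj
    have h1 := congrArg (fun f : MuntzSpace r m => (f : ℝ → ℝ) t) (B.sum_repr (muntzPower r hj))
    have h2 : (muntzPower r hj : ℝ → ℝ) t = t ^ r j := rfl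
    rw [← htx, ← h2, ← h1]
    have h3 : ∀ l, B.repr (muntzPower r hj) l = (Q l).eval (r j) := fun l => hlink l hj
    simp only [h3]
    simp [mul_comm]
  have hsum1 := hsum 1 (by omega)
  rw [div_self hr1.ne', Real.rpow_one] at hsum1
  rw [← hsum k hkm]
  have hone := hB.2 t
  -- The `σ` term averages to zero because `∑ l, B l t * Q l (r 1) = x`; then each vertex is
  -- compared with the supporting line.
  calc (Q i).eval (r k)
      = ∑ l, (B l : ℝ → ℝ) t * ((Q i).eval (r k) + σ * ((Q l).eval (r 1) - x)) := by
        have h1 : ∑ l, (B l : ℝ → ℝ) t * ((Q i).eval (r k) + σ * ((Q l).eval (r 1) - x)) =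
            (∑ l, (B l : ℝ → ℝ) t) * ((Q i).eval (r k) - σ * x) +
              σ * ∑ l, (B l : ℝ → ℝ) t * (Q l).eval (r 1) := by
          rw [Finset.sum_mul, Finset.mul_sum, ← Finset.sum_add_distrib]
          exact Finset.sum_congr rfl fun l _ => by ring
        rw [h1, hone, hsum1]; ring
    _ ≤ _ := Finset.sum_le_sum fun l _ => mul_le_mul_of_nonneg_left (hσ l (by omega))
        (chebyshevBernsteinBasis_pos h0 hr ha ha1 l htI).le

/-- The reverse of Jensen's inequality for the control polygon holds asymptotically. -/
theorem rpow_sub_le_controlPoint (h0 : r 0 = 0) (hr : StrictMono r) (ha : 0 < a) (ha1 : a < 1)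
    {k : ℕ} (hk : 1 ≤ k) (hkm : k ≤ m) {δ : ℝ}
    (hδ : ∀ j, (∏ l ∈ Finset.Ioc j m, (1 - r 1 / r l)) ^ (r k / r 1) - δ ≤
      ∏ l ∈ Finset.Ioc j m, (1 - r k / r l)) (i : Fin (m + 1)) :
    controlPoint h0 hr ha ha1 (muntzPower r (hk.trans hkm)) i ^ (r k / r 1) - δ ≤
      controlPoint h0 hr ha ha1 (muntzPower r hkm) i := by
  have h0n : (0 : ℝ) ∈ nodes r m := h0 ▸ mem_nodes (Nat.zero_le _)
  have hr1 : 0 < r 1 := by rw [← h0]; exact hr one_pos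
  obtain ⟨q, p, h, hq⟩ := exists_isInterpolant_normalized (S := nodes r m) (d := m - i) (i := i)
    ha ha1 (by rw [card_nodes hr]; omega) h0n
  rw [controlPoint_muntzPower h0 hr ha ha1 i h hq, controlPoint_muntzPower h0 hr ha ha1 i h hq]
  obtain ⟨w, hw, hwe⟩ := IsInterpolant.exists_weights h0 hr ha ha1 (m - i) i q p
    (by rwa [Nat.sub_add_cancel (by omega)]) hq
  rw [Nat.sub_add_cancel (by omega)] at hwe
  -- At the node `r 0 = 0` every product equals `1`.
  have hw1 : ∑ j ∈ Finset.range (m + 1), w j = 1 := by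
    have := hwe 0 (Nat.zero_le _)
    rw [h0, hq] at this
    simpa using this.symm
  rw [hwe 1 (hk.trans hkm), hwe k hkm]
  -- Convexity of the power `r k / r 1 ≥ 1`; since the weights sum to `1`, averaging costs only a
  -- single `δ`.
  have hJ := Real.rpow_arith_mean_le_arith_mean_rpow (Finset.range (m + 1)) w
    (fun j => ∏ l ∈ Finset.Ioc j m, (1 - r 1 / r l)) (fun j _ => hw j) hw1
    (fun j _ => Finset.prod_nonneg fun l hl => by
      have hl : 1 ≤ l := by have := (Finset.mem_Ioc.1 hl).1; omega
      have hrl : r 1 ≤ r l := hr.monotone hl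
      rw [sub_nonneg, div_le_one (hr1.trans_le hrl)]
      exact hrl)
    (p := r k / r 1) (by rw [one_le_div hr1]; exact hr.monotone hk)
  have h2 := Finset.sum_le_sum fun j (_ : j ∈ Finset.range (m + 1)) =>
    mul_le_mul_of_nonneg_left (hδ j) (hw j)
  simp only [mul_sub, Finset.sum_sub_distrib, ← Finset.sum_mul, hw1, one_mul] at h2
  linarith

end MuntzElevation

theorem theorem7 (r : ℕ → ℝ) (h0 : r 0 = 0) (hr : StrictMono r)
    (hlim : Filter.Tendsto r Filter.atTop Filter.atTop)
    (hmuntz : ¬ Summable fun i : ℕ => 1 / r (i + 1))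
    (a : ℝ) (ha : 0 < a) (ha1 : a < 1) (k : ℕ) (hk : 1 ≤ k) :
    ∀ ε : ℝ, 0 < ε → ∃ M : ℕ, ∀ (m : ℕ) (hkm : k ≤ m), M ≤ m → ∀ i : Fin (m + 1),
      |MuntzElevation.controlPoint h0 hr ha ha1
            (MuntzElevation.muntzPower r (hk.trans hkm)) i ^ (r k / r 1)
        - MuntzElevation.controlPoint h0 hr ha ha1 (MuntzElevation.muntzPower r hkm) i| < ε := by
  intro ε hε
  obtain ⟨M, hM⟩ := MuntzElevation.prod_rpow_sub_le r h0 hr hlim hmuntz k hk (half_pos hε)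
  refine ⟨M, fun m hkm hMm i => ?_⟩
  have h1 := MuntzElevation.controlPoint_le_rpow h0 hr ha ha1 hk hkm i
  have h2 := MuntzElevation.rpow_sub_le_controlPoint h0 hr ha ha1 hk hkm (hM m hMm hkm) i
  rw [abs_lt]
  constructor <;> linarith
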